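/- Let $N^5_s(c)$ be a $5$-dimensional pseudo-Riemannian manifold of constant sectional curvature $c$ and arbitrary index $s$, and let $x: M^4_r\to N^5_s(c)$ be a connected nondegenerate immersed hypersurface (all objects smooth) with a unit normal vector field $\vec\xi$, $\varepsilon=\langle\vec\xi,\vec\xi\rangle=\pm1$. Let $A$ be the shape operator associated with $\vec\xi$ (so $\widetilde\nabla_X\vec\xi=-dx(AX)$, with $\widetilde\nabla$ the Levi-Civita connection of $N^5_s(c)$), $H=\frac14\varepsilon\,\mathrm{tr}A$ the mean curvature and $\vec H=H\vec\xi$ the mean curvature vector field. Suppose that $\Delta\vec H=\lambda\vec H$ for a real constant $\lambda$, where $\Delta=-\sum_{i=1}^4\varepsilon_i(\widetilde\nabla_{e_i}\widetilde\nabla_{e_i}-\widetilde\nabla_{\nabla_{e_i}e_i})$ for local orthonormal frames $\{e_i\}$ of $M^4_r$ with $\langle e_i,e_i\rangle=\varepsilon_i=\pm1$, and $\nabla$ is the Levi-Civita connection of $M^4_r$. Suppose also that at every point $M^4_r$ has exactly two distinct principal curvatures (complex eigenvalues of $A$) and that both are imaginary, i.e. non-real (hence they are complex conjugate). Then: - if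 $c\varepsilon\ge 0$, then $H=0$ on $M^4_r$; - if $c\varepsilon<0$ and $|\varepsilon\lambda|\ge -4c\varepsilon$, then $H=0$ on $M^4_r$; - if $c\varepsilon<0$ and $|\varepsilon\lambda|<-4c\varepsilon$, then either $H=0$ on $M^4_r$, or $H^2=\dfrac{\varepsilon\lambda-4c\varepsilon}{8}$ on $M^4_r$. -/

import Mathlib

set_option maxSynthPendingDepth 3

open scoped Manifold ContDiff

noncomputable section

/-! ### Pseudo-Riemannian calculus in coordinates

In this section a metric on (an open subset of) a finite-dimensional vector space is a field `G` of
symmetric bilinear forms, and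
`(G y).inverse : (E →L[ℝ] ℝ) →L[ℝ] E` is the index-raising map of a nondegenerate form `G y`. -/

namespace LocalGeometry

variable {E F : Type*} [NormedAddCommGroup E] [NormedSpace ℝ E]
  [NormedAddCommGroup F] [NormedSpace ℝ F]

/-- The functional of the Koszul formula for constant vector fields `u, v, w`:
`½ (∂_u G(v, w) + ∂_v G(u, w) - ∂_w G(u, v))`. -/
def koszul (G : F → F →L[ℝ] F →L[ℝ] ℝ) (y : F) :
    F →L[ℝ] F →L[ℝ] F →L[ℝ] ℝ :=
  let D : F →L[ℝ] F →L[ℝ] F →L[ℝ] ℝ := fderiv ℝ G y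
  let T : (F →L[ℝ] F →L[ℝ] ℝ) →L[ℝ] (F →L[ℝ] F →L[ℝ] ℝ) :=
    (ContinuousLinearMap.flipₗᵢ ℝ F F ℝ).toContinuousLinearEquiv
  (1 / 2 : ℝ) • (D + D.flip - T ∘L D.flip)

theorem koszul_apply (G : F → F →L[ℝ] F →L[ℝ] ℝ) (y u v w : F) :
    koszul G y u v w =
      1 / 2 * (fderiv ℝ G y u v w + fderiv ℝ G y v u w - fderiv ℝ G y w u v) := by
  simp [koszul]

/-- The Christoffel symbols of the Levi-Civita connection of `G`, as a bilinear map: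
`christoffel G y u v = ∇_u v` at `y`, for constant vector fields `u`, `v`. -/
def christoffel (G : F → F →L[ℝ] F →L[ℝ] ℝ) (y : F) :
    F →L[ℝ] F →L[ℝ] F :=
  (ContinuousLinearMap.compL ℝ F (F →L[ℝ] ℝ) F (G y).inverse) ∘L koszul G y

theorem christoffel_apply (G : F → F →L[ℝ] F →L[ℝ] ℝ) (y u v : F) :
    christoffel G y u v = (G y).inverse (koszul G y u v) := rfl

/-- The curvature tensor `R(u, v) w = ∇_u ∇_v w - ∇_v ∇_u w - ∇_[u, v] w` of `G`, evaluated on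
constant vector fields. -/
def curvature (G : F → F →L[ℝ] F →L[ℝ] ℝ) (y u v w : F) : F :=
  fderiv ℝ (fun z => christoffel G z v w) y u - fderiv ℝ (fun z => christoffel G z u w) y v
    + christoffel G y u (christoffel G y v w) - christoffel G y v (christoffel G y u w)

/-- The metric induced by `G` through the map `f`. -/
def pullbackMetric (G : F → F →L[ℝ] F →L[ℝ] ℝ) (f : E → F) :
    E → E →L[ℝ] E →L[ℝ] ℝ :=
  fun y => (G (f y)).bilinearComp (fderiv ℝ f y) (fderiv ℝ f y)

/-- The covariant derivative, for the Levi-Civita connection of `G`, of a vector field `s` along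
the map `f`: `u ↦ ∂_u s + Γ(df(u), s)`. -/
def covDerivAlong (G : F → F →L[ℝ] F →L[ℝ] ℝ) (f s : E → F)
    (y : E) : E →L[ℝ] F :=
  fderiv ℝ s y + (christoffel G (f y)).flip (s y) ∘L fderiv ℝ f y

/-- The shape operator of the immersion `f` associated to the normal field `ν`:
`⟨A u, v⟩ = -⟨∇̃_u ν, df(v)⟩` for the induced metric, so that `-df(A u)` is the tangential
part of `∇̃_u ν`. -/
def shapeOp (G : F → F →L[ℝ] F →L[ℝ] ℝ) (f ν : E → F)
    (y : E) : E →L[ℝ] E :=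
  (pullbackMetric G f y).inverse ∘L
    (-(G (f y)).bilinearComp (covDerivAlong G f ν y) (fderiv ℝ f y))

/-- The coordinate space `ℝⁿ`. -/
abbrev Coord (n : ℕ) : Type := EuclideanSpace ℝ (Fin n)

variable {m n : ℕ}

/-- The entries `h^{ij}` of the inverse of the matrix of a nondegenerate symmetric form `h`. -/
def invEntry (h : Coord m →L[ℝ] Coord m →L[ℝ] ℝ) (i j : Fin m) : ℝ :=
  h.inverse (EuclideanSpace.proj i) j

/-- The Laplacian of a vector field `s` along the immersion `f`, with the sign convention
`Δ s = - ∑ h^{ij} (∇̃_i ∇̃_j s - ∇̃_{∇_i ∂_j} s)`, where `h` is the induced metric, `∇` its Levi-Civita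
connection and `∇̃` the Levi-Civita connection of `G`. -/
def laplacian (G : Coord n → Coord n →L[ℝ] Coord n →L[ℝ] ℝ) (f s : Coord m → Coord n)
    (y : Coord m) : Coord n :=
  -∑ i : Fin m, ∑ j : Fin m, invEntry (pullbackMetric G f y) i j •
    (covDerivAlong G f (fun z => covDerivAlong G f s z (EuclideanSpace.single j 1)) y
        (EuclideanSpace.single i 1)
      - covDerivAlong G f s y (christoffel (pullbackMetric G f) y
          (EuclideanSpace.single i 1) (EuclideanSpace.single j 1)))

end LocalGeometry

open LocalGeometry

/-! ### Pseudo-Riemannian manifolds -/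

section Manifolds

variable {m n : ℕ}
  {M : Type*} [TopologicalSpace M] [ChartedSpace (EuclideanSpace ℝ (Fin m)) M]
  {N : Type*} [TopologicalSpace N] [ChartedSpace (EuclideanSpace ℝ (Fin n)) N]

/-- The coordinate expression, in the chart around `q₀`, of a field `B` of bilinear forms on the
tangent spaces of `N`; it is meaningful on the target of the chart. -/
def bilinInChart (B : ∀ q : N, TangentSpace (𝓡 n) q →L[ℝ] TangentSpace (𝓡 n) q →L[ℝ] ℝ)
    (q₀ : N) (z : Coord n) : Coord n →L[ℝ] Coord n →L[ℝ] ℝ :=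
  let b : Coord n →L[ℝ] Coord n →L[ℝ] ℝ := B ((extChartAt (𝓡 n) q₀).symm z)
  let L : Coord n →L[ℝ] Coord n := mfderiv (𝓡 n) (𝓡 n) (extChartAt (𝓡 n) q₀).symm z
  b.bilinearComp L L

variable (n N) in
/-- A smooth pseudo-Riemannian metric, of arbitrary signature. -/
structure PseudoRiemannianMetric where
  /-- The scalar product on each tangent space. -/
  inner : ∀ q : N, TangentSpace (𝓡 n) q →L[ℝ] TangentSpace (𝓡 n) q →L[ℝ] ℝ
  symm : ∀ (q : N) (u v : TangentSpace (𝓡 n) q), inner q u v = inner q v u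
  nondegenerate : ∀ (q : N) (u : TangentSpace (𝓡 n) q), (∀ v, inner q u v = 0) → u = 0
  smooth : ∀ q₀ : N, ContDiffOn ℝ ∞ (bilinInChart inner q₀) (extChartAt (𝓡 n) q₀).target

namespace PseudoRiemannianMetric

/-- The metric in the chart around `q₀`. -/
def inChart (g : PseudoRiemannianMetric n N) (q₀ : N) :
    Coord n → Coord n →L[ℝ] Coord n →L[ℝ] ℝ :=
  bilinInChart g.inner q₀

/-- The sectional curvature `⟨R(u, v) v, u⟩ / (⟨u, u⟩ ⟨v, v⟩ - ⟨u, v⟩ ^ 2)` of every nondegenerate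
tangent plane is `c`. The condition is expressed in coordinates, in the charts of `N`. -/
def HasConstantSectionalCurvature (g : PseudoRiemannianMetric n N) (c : ℝ) : Prop :=
  ∀ q₀ : N, ∀ z ∈ (extChartAt (𝓡 n) q₀).target, ∀ u v : Coord n,
    let G := g.inChart q₀
    G z u u * G z v v - G z u v ^ 2 ≠ 0 →
      G z (curvature G z u v v) u / (G z u u * G z v v - G z u v ^ 2) = c

end PseudoRiemannianMetric

/-- The coordinate expression, near `p₀`, of a map `x : M → N`. -/
def mapInChart (x : M → N) (p₀ : M) : Coord m → Coord n :=
  fun y => extChartAt (𝓡 n) (x p₀) (x ((extChartAt (𝓡 m) p₀).symm y))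

/-- The coordinate expression, near `p₀`, of a vector field `s` along a map `x : M → N`. -/
def fieldInChart (x : M → N) (s : ∀ p : M, TangentSpace (𝓡 n) (x p)) (p₀ : M) :
    Coord m → Coord n :=
  fun y => mfderiv (𝓡 n) (𝓡 n) (extChartAt (𝓡 n) (x p₀)) (x ((extChartAt (𝓡 m) p₀).symm y))
    (s ((extChartAt (𝓡 m) p₀).symm y))

variable (m) in
/-- `x : M → N` is a smooth immersion whose induced metric is nondegenerate. -/
structure IsNondegenerateImmersion (g : PseudoRiemannianMetric n N) (x : M → N) : Prop where
  smooth : ContMDiff (𝓡 m) (𝓡 n) ∞ x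
  immersion : ∀ p : M, Function.Injective (mfderiv (𝓡 m) (𝓡 n) x p)
  nondegenerate : ∀ (p : M) (u : TangentSpace (𝓡 m) p),
    (∀ v : TangentSpace (𝓡 m) p,
      g.inner (x p) (mfderiv (𝓡 m) (𝓡 n) x p u) (mfderiv (𝓡 m) (𝓡 n) x p v) = 0) → u = 0

variable (m) in
/-- `ξ` is a smooth unit normal field along `x`, with `⟨ξ, ξ⟩ = ε = ±1`. -/
structure IsUnitNormal [IsManifold (𝓡 n) ∞ N] (g : PseudoRiemannianMetric n N) (x : M → N)
    (ξ : ∀ p : M, TangentSpace (𝓡 n) (x p)) (ε : ℝ) : Prop where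
  smooth : ContMDiff (𝓡 m) (𝓡 n).tangent ∞ (fun p => (⟨x p, ξ p⟩ : TangentBundle (𝓡 n) N))
  normal : ∀ (p : M) (u : TangentSpace (𝓡 m) p),
    g.inner (x p) (ξ p) (mfderiv (𝓡 m) (𝓡 n) x p u) = 0
  inner_self : ∀ p : M, g.inner (x p) (ξ p) (ξ p) = ε
  sign : ε = 1 ∨ ε = -1

/-- The shape operator of `x` at `p` associated to `ξ`, computed in the charts around
`p` and `x p` (whose coordinate vectors are Mathlib's tangent vectors at `p` and `x p`). -/
def shapeOperator (g : PseudoRiemannianMetric n N) (x : M → N)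
    (ξ : ∀ p : M, TangentSpace (𝓡 n) (x p)) (p : M) :
    TangentSpace (𝓡 m) p →L[ℝ] TangentSpace (𝓡 m) p :=
  shapeOp (g.inChart (x p)) (mapInChart x p) (fieldInChart x ξ p) (extChartAt (𝓡 m) p p)

variable (m) in
/-- The principal curvatures at `p`: the real and complex eigenvalues of the shape operator,
i.e. the complex roots of its characteristic polynomial. -/
def principalCurvatures (g : PseudoRiemannianMetric n N) (x : M → N)
    (ξ : ∀ p : M, TangentSpace (𝓡 n) (x p)) (p : M) : Set ℂ :=
  let A : Coord m →ₗ[ℝ] Coord m := (shapeOperator (m := m) g x ξ p).toLinearMap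
  {μ | (A.charpoly.map (algebraMap ℝ ℂ)).IsRoot μ}

variable (m) in
/-- The mean curvature `H = (1 / m) ε tr A`, where `ε = ⟨ξ, ξ⟩`. -/
def meanCurvature (g : PseudoRiemannianMetric n N) (x : M → N)
    (ξ : ∀ p : M, TangentSpace (𝓡 n) (x p)) (p : M) : ℝ :=
  let A : Coord m →ₗ[ℝ] Coord m := (shapeOperator (m := m) g x ξ p).toLinearMap
  1 / (m : ℝ) * g.inner (x p) (ξ p) (ξ p) * LinearMap.trace ℝ (Coord m) A

variable (m) in
/-- The mean curvature vector field `H ξ`. -/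
def meanCurvatureVector (g : PseudoRiemannianMetric n N) (x : M → N)
    (ξ : ∀ p : M, TangentSpace (𝓡 n) (x p)) (p : M) : TangentSpace (𝓡 n) (x p) :=
  meanCurvature m g x ξ p • ξ p

variable (m) in
/-- The Laplacian `Δ s = - ∑ εᵢ (∇̃_{eᵢ} ∇̃_{eᵢ} s - ∇̃_{∇_{eᵢ} eᵢ} s)` of a vector field `s` along `x`,
at the point `p`, computed in the charts around `p` and `x p`. -/
def laplacianAlong (g : PseudoRiemannianMetric n N) (x : M → N)
    (s : ∀ p : M, TangentSpace (𝓡 n) (x p)) (p : M) : TangentSpace (𝓡 n) (x p) :=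
  laplacian (g.inChart (x p)) (mapInChart x p) (fieldInChart x s p) (extChartAt (𝓡 m) p p)

variable (m) in
/-- The mean curvature vector field is proper with constant `lam`: `Δ H⃗ = lam H⃗`. -/
def HasProperMeanCurvature (g : PseudoRiemannianMetric n N) (x : M → N)
    (ξ : ∀ p : M, TangentSpace (𝓡 n) (x p)) (lam : ℝ) : Prop :=
  ∀ p : M, laplacianAlong m g x (meanCurvatureVector m g x ξ) p = lam • meanCurvatureVector m g x ξ p

end Manifolds

end

/-!
In charts, the Gauss and Weingarten formulas split `Δ H⃗ = λ H⃗` into two parts. The tangential part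
exhibits the gradient of `H` as an eigenvector of the shape operator `A` with eigenvalue a real
multiple of `H`, at points where `H ≠ 0`; as `A` has no real eigenvalue, `H` is locally constant,
hence constant. If `H ≠ 0`, the normal part then reads `tr A² = ε λ`. With eigenvalues `α ± iβ`,
each of algebraic multiplicity two, this gives `H = ε α` and `ε λ = 4 (α² - β²)`, so `α` and `β`
are constant.

The last relation is the Cartan identity `c + ε (α² + β²) = 0`. The field `K = (A - α) / β`
satisfies `(K² + 1)² = 0` and the Codazzi equation. If `K² = -1` everywhere, this forces `∇K = 0`.
At a point where `K² ≠ -1`, `K` splits into a complex structure and a commuting nilpotent, and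
`∇_X K` commutes with `K` for `X` in the kernel of `K² + 1`. In both cases there is some `n ≠ 0` in
this kernel such that `[R(n, K n), K]` commutes with `K`, by the Ricci identity. But the Gauss
equation makes `R(n, K n)` the multiple of `n ∧ K n` by `c + ε (α² + β²)`, which therefore
vanishes. Hence `c ε = -(α² + β²) < 0`, and eliminating `β` yields `H² = (ε λ - 4 c ε) / 8` and
`|ε λ| < -4 c ε`.
-/

noncomputable section

namespace LocalGeometry

section LocalHypersurface

variable {E F : Type*} [NormedAddCommGroup E] [NormedSpace ℝ E]
  [NormedAddCommGroup F] [NormedSpace ℝ F]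

/-! ### Derivatives of fields of linear and bilinear maps -/

section Calculus

variable {H K : Type*} [NormedAddCommGroup H] [NormedSpace ℝ H]
  [NormedAddCommGroup K] [NormedSpace ℝ K] {y : E} {k : ℕ∞ω}

theorem fderiv_fderiv_comm {f : E → F} (hf : ContDiffAt ℝ ∞ f y) (u v : E) :
    fderiv ℝ (fderiv ℝ f) y u v = fderiv ℝ (fderiv ℝ f) y v u :=
  (hf.isSymmSndFDerivAt (by simpa using ENat.LEInfty.out)).eq u v

theorem contDiffAt_fderiv {f : E → F} (hf : ContDiffAt ℝ ∞ f y) :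
    ContDiffAt ℝ ∞ (fderiv ℝ f) y :=
  hf.fderiv_right (by simp)

theorem fderiv_clm_apply_const {B : E → F →L[ℝ] H} (hB : DifferentiableAt ℝ B y) (w : E) (u : F) :
    fderiv ℝ (fun z => B z u) y w = fderiv ℝ B y w u := by
  simp [fderiv_clm_apply hB (differentiableAt_const u)]

theorem fderiv_clm_apply₂_const {B : E → F →L[ℝ] H →L[ℝ] K} (hB : DifferentiableAt ℝ B y)
    (w : E) (u : F) (v : H) : fderiv ℝ (fun z => B z u v) y w = fderiv ℝ B y w u v := by
  rw [fderiv_clm_apply_const (B := fun z => B z u) (by fun_prop), fderiv_clm_apply_const hB]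

theorem fderiv_bilin_comp {B : F → F →L[ℝ] H →L[ℝ] K} {f s : E → F} {t : E → H}
    (hB : DifferentiableAt ℝ B (f y)) (hf : DifferentiableAt ℝ f y)
    (hs : DifferentiableAt ℝ s y) (ht : DifferentiableAt ℝ t y) (w : E) :
    fderiv ℝ (fun z => B (f z) (s z) (t z)) y w =
      fderiv ℝ B (f y) (fderiv ℝ f y w) (s y) (t y) + B (f y) (fderiv ℝ s y w) (t y)
        + B (f y) (s y) (fderiv ℝ t y w) := by
  have hBf : HasFDerivAt (fun z => B (f z)) (fderiv ℝ B (f y) ∘L fderiv ℝ f y) y :=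
    hB.hasFDerivAt.comp y hf.hasFDerivAt
  rw [((hBf.clm_apply hs.hasFDerivAt).clm_apply ht.hasFDerivAt).fderiv]
  simp only [add_apply, ContinuousLinearMap.comp_apply, ContinuousLinearMap.flip_apply]
  abel

theorem contDiffAt_clm_flip {B : E → F →L[ℝ] H →L[ℝ] K} (hB : ContDiffAt ℝ k B y) :
    ContDiffAt ℝ k (fun z => (B z).flip) y :=
  (ContinuousLinearMap.flipₗᵢ ℝ F H K).toContinuousLinearEquiv.contDiff.contDiffAt.comp y hB

theorem contDiffAt_bilinearComp {B : E → F →L[ℝ] F →L[ℝ] ℝ} {L L' : E → H →L[ℝ] F}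
    (hB : ContDiffAt ℝ k B y) (hL : ContDiffAt ℝ k L y) (hL' : ContDiffAt ℝ k L' y) :
    ContDiffAt ℝ k (fun z => (B z).bilinearComp (L z) (L' z)) y :=
  contDiffAt_clm_flip ((contDiffAt_clm_flip (hB.clm_comp hL)).clm_comp hL')

end Calculus

theorem isInvertible_of_nondegenerate [FiniteDimensional ℝ F] {b : F →L[ℝ] F →L[ℝ] ℝ}
    (hb : ∀ u, (∀ v, b u v = 0) → u = 0) : b.IsInvertible := by
  have hinj : Function.Injective b :=
    (injective_iff_map_eq_zero b).2 fun u hu => hb u fun v => by simp [hu]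
  let toDual := LinearMap.toContinuousLinearMap (𝕜 := ℝ) (E := F) (F' := ℝ)
  have : FiniteDimensional ℝ (F →L[ℝ] ℝ) := toDual.finiteDimensional
  have hdim : Module.finrank ℝ F = Module.finrank ℝ (F →L[ℝ] ℝ) :=
    Subspace.dual_finrank_eq.symm.trans toDual.finrank_eq
  exact ⟨(LinearEquiv.ofInjectiveOfFinrankEq b.toLinearMap hinj hdim).toContinuousLinearEquiv,
    by ext; rfl⟩

/-! ### Metrics on open subsets of a vector space -/

/-- `G` restricts to a smooth pseudo-Riemannian metric, of arbitrary signature, on the open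
set `V`; this is the form in which the metrics of `M` and `N` appear in charts. -/
structure IsLocalMetric (G : F → F →L[ℝ] F →L[ℝ] ℝ) (V : Set F) : Prop where
  isOpen : IsOpen V
  contDiffAt : ∀ z ∈ V, ContDiffAt ℝ ∞ G z
  symm : ∀ z ∈ V, ∀ u v, G z u v = G z v u
  nondegenerate : ∀ z ∈ V, ∀ u, (∀ v, G z u v = 0) → u = 0

variable {G : F → F →L[ℝ] F →L[ℝ] ℝ} {V : Set F}

namespace IsLocalMetric

variable (hG : IsLocalMetric G V) {z : F} (hz : z ∈ V)

include hG hz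

theorem mem_nhds : V ∈ nhds z :=
  hG.isOpen.mem_nhds hz

theorem differentiableAt : DifferentiableAt ℝ G z :=
  (hG.contDiffAt z hz).differentiableAt (by simp)

theorem ext_inner {u v : F} (h : ∀ w, G z u w = G z v w) : u = v :=
  sub_eq_zero.1 <| hG.nondegenerate z hz _ fun w => by simp [h w]

theorem fderiv_symm (u v w : F) : fderiv ℝ G z u v w = fderiv ℝ G z u w v := by
  have hsymm : (fun y => G y v w) =ᶠ[nhds z] fun y => G y w v :=
    Filter.mem_of_superset (hG.mem_nhds hz) fun y hy => hG.symm y hy v w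
  rw [← fderiv_clm_apply₂_const (hG.differentiableAt hz), hsymm.fderiv_eq,
    fderiv_clm_apply₂_const (hG.differentiableAt hz)]

theorem contDiffAt_koszul : ContDiffAt ℝ ∞ (koszul G) z := by
  have hD := contDiffAt_fderiv (hG.contDiffAt z hz)
  exact ((hD.add (contDiffAt_clm_flip hD)).sub
    (contDiffAt_const.clm_comp (contDiffAt_clm_flip hD))).const_smul _

variable [FiniteDimensional ℝ F]

theorem isInvertible : (G z).IsInvertible :=
  isInvertible_of_nondegenerate (hG.nondegenerate z hz)

theorem inner_christoffel (u v w : F) : G z (christoffel G z u v) w = koszul G z u v w := by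
  rw [christoffel_apply, (hG.isInvertible hz).self_apply_inverse]

theorem christoffel_symm (u v : F) : christoffel G z u v = christoffel G z v u :=
  hG.ext_inner hz fun w => by
    rw [hG.inner_christoffel hz, hG.inner_christoffel hz, koszul_apply, koszul_apply,
      hG.fderiv_symm hz w u v]
    ring

theorem fderiv_eq_christoffel (u v w : F) :
    fderiv ℝ G z u v w = G z (christoffel G z u v) w + G z v (christoffel G z u w) := by
  rw [hG.symm z hz v, hG.inner_christoffel hz, hG.inner_christoffel hz, koszul_apply,
    koszul_apply, hG.fderiv_symm hz u w v]
  ring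

theorem contDiffAt_inverse : ContDiffAt ℝ ∞ (fun y => (G y).inverse) z :=
  have := FiniteDimensional.complete ℝ F
  (hG.isInvertible hz).contDiffAt_map_inverse.comp z (hG.contDiffAt z hz)

theorem contDiffAt_christoffel : ContDiffAt ℝ ∞ (christoffel G) z :=
  ((ContinuousLinearMap.compL ℝ F (F →L[ℝ] ℝ) F).contDiff.contDiffAt.comp z
    (hG.contDiffAt_inverse hz)).clm_comp (hG.contDiffAt_koszul hz)

theorem differentiableAt_christoffel : DifferentiableAt ℝ (christoffel G) z :=
  (hG.contDiffAt_christoffel hz).differentiableAt (by simp)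

theorem fderiv_christoffel_symm (u v w : F) :
    fderiv ℝ (christoffel G) z u v w = fderiv ℝ (christoffel G) z u w v := by
  have hΓ := hG.differentiableAt_christoffel hz
  have hsymm : (fun y => christoffel G y v w) =ᶠ[nhds z] fun y => christoffel G y w v :=
    Filter.mem_of_superset (hG.mem_nhds hz) fun y hy => hG.christoffel_symm hy v w
  rw [← fderiv_clm_apply₂_const hΓ, hsymm.fderiv_eq, fderiv_clm_apply₂_const hΓ]

theorem curvature_eq (u v w : F) : curvature G z u v w =
    fderiv ℝ (christoffel G) z u v w - fderiv ℝ (christoffel G) z v u w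
      + christoffel G z u (christoffel G z v w) - christoffel G z v (christoffel G z u w) := by
  rw [curvature, fderiv_clm_apply₂_const (hG.differentiableAt_christoffel hz),
    fderiv_clm_apply₂_const (hG.differentiableAt_christoffel hz)]

theorem curvature_bianchi (u v w : F) :
    curvature G z u v w + curvature G z v w u + curvature G z w u v = 0 := by
  simp only [hG.curvature_eq hz]
  rw [hG.fderiv_christoffel_symm hz u w v, hG.fderiv_christoffel_symm hz v w u,
    hG.fderiv_christoffel_symm hz w v u, hG.christoffel_symm hz w u, hG.christoffel_symm hz v u,
    hG.christoffel_symm hz w v]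
  abel

end IsLocalMetric

theorem curvature_antisymm (G : F → F →L[ℝ] F →L[ℝ] ℝ) (z u v w : F) :
    curvature G z u v w = -curvature G z v u w := by
  simp only [curvature]
  abel

/-! ### Vector fields along maps -/

theorem covDerivAlong_apply (G : F → F →L[ℝ] F →L[ℝ] ℝ) (f s : E → F) (y u : E) :
    covDerivAlong G f s y u =
      fderiv ℝ s y u + christoffel G (f y) (fderiv ℝ f y u) (s y) := rfl

theorem pullbackMetric_apply (G : F → F →L[ℝ] F →L[ℝ] ℝ) (f : E → F) (y u v : E) :
    pullbackMetric G f y u v = G (f y) (fderiv ℝ f y u) (fderiv ℝ f y v) := rfl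

section CovDerivAlong

variable {f s t : E → F} {y : E}

theorem covDerivAlong_congr (h : s =ᶠ[nhds y] t) :
    covDerivAlong G f s y = covDerivAlong G f t y := by
  rw [covDerivAlong, covDerivAlong, h.fderiv_eq, h.eq_of_nhds]

theorem covDerivAlong_neg : covDerivAlong G f (fun z => -s z) y = -covDerivAlong G f s y := by
  ext u
  simp only [covDerivAlong_apply, fderiv_fun_neg, neg_apply, map_neg]
  abel

theorem covDerivAlong_add (hs : DifferentiableAt ℝ s y) (ht : DifferentiableAt ℝ t y) :
    covDerivAlong G f (fun z => s z + t z) y =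
      covDerivAlong G f s y + covDerivAlong G f t y := by
  ext u
  simp only [covDerivAlong_apply, fderiv_fun_add hs ht, add_apply, map_add]
  abel

theorem covDerivAlong_smul {φ : E → ℝ} (hφ : DifferentiableAt ℝ φ y) (hs : DifferentiableAt ℝ s y)
    (u : E) : covDerivAlong G f (fun z => φ z • s z) y u =
      fderiv ℝ φ y u • s y + φ y • covDerivAlong G f s y u := by
  simp only [covDerivAlong_apply, fderiv_fun_smul hφ hs, add_apply, map_smul, smul_add,
    smul_apply, ContinuousLinearMap.smulRight_apply]
  abel

theorem contDiffAt_pullbackMetric (hG : ContDiffAt ℝ ∞ G (f y)) (hf : ContDiffAt ℝ ∞ f y) :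
    ContDiffAt ℝ ∞ (pullbackMetric G f) y :=
  contDiffAt_bilinearComp (hG.comp y hf) (contDiffAt_fderiv hf) (contDiffAt_fderiv hf)

variable (hG : IsLocalMetric G V) (hy : f y ∈ V)

include hG hy

theorem fderiv_pullbackMetric (hf : ContDiffAt ℝ ∞ f y) (a b d : E) :
    fderiv ℝ (pullbackMetric G f) y a b d =
      fderiv ℝ G (f y) (fderiv ℝ f y a) (fderiv ℝ f y b) (fderiv ℝ f y d)
        + G (f y) (fderiv ℝ (fderiv ℝ f) y a b) (fderiv ℝ f y d)
        + G (f y) (fderiv ℝ f y b) (fderiv ℝ (fderiv ℝ f) y a d) := by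
  have hdf : DifferentiableAt ℝ (fderiv ℝ f) y := (contDiffAt_fderiv hf).differentiableAt (by simp)
  rw [← fderiv_clm_apply₂_const
    ((contDiffAt_pullbackMetric (hG.contDiffAt _ hy) hf).differentiableAt (by simp))]
  simp only [pullbackMetric_apply]
  rw [fderiv_bilin_comp (hG.differentiableAt hy) (hf.differentiableAt (by simp))
    (by fun_prop) (by fun_prop), fderiv_clm_apply_const hdf, fderiv_clm_apply_const hdf]

theorem koszul_pullbackMetric (hf : ContDiffAt ℝ ∞ f y) (u v w : E) :
    koszul (pullbackMetric G f) y u v w =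
      koszul G (f y) (fderiv ℝ f y u) (fderiv ℝ f y v) (fderiv ℝ f y w)
        + G (f y) (fderiv ℝ (fderiv ℝ f) y u v) (fderiv ℝ f y w) := by
  simp only [koszul_apply, fderiv_pullbackMetric hG hy hf]
  rw [fderiv_fderiv_comm hf v u, fderiv_fderiv_comm hf w u, fderiv_fderiv_comm hf w v,
    hG.symm _ hy (fderiv ℝ f y v) (fderiv ℝ (fderiv ℝ f) y u w),
    hG.symm _ hy (fderiv ℝ f y u) (fderiv ℝ (fderiv ℝ f) y v w)]
  ring

variable [FiniteDimensional ℝ F]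

theorem fderiv_inner_along (hf : DifferentiableAt ℝ f y) (hs : DifferentiableAt ℝ s y)
    (ht : DifferentiableAt ℝ t y) (u : E) :
    fderiv ℝ (fun z => G (f z) (s z) (t z)) y u =
      G (f y) (covDerivAlong G f s y u) (t y) + G (f y) (s y) (covDerivAlong G f t y u) := by
  rw [fderiv_bilin_comp (hG.differentiableAt hy) hf hs ht, hG.fderiv_eq_christoffel hy]
  simp only [covDerivAlong_apply, map_add, add_apply]
  ring

theorem contDiffAt_covDerivAlong (hf : ContDiffAt ℝ ∞ f y) (hs : ContDiffAt ℝ ∞ s y) :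
    ContDiffAt ℝ ∞ (covDerivAlong G f s) y := by
  have hΓ : ContDiffAt ℝ ∞ (fun z => christoffel G (f z)) y :=
    (hG.contDiffAt_christoffel hy).comp y hf
  exact (contDiffAt_fderiv hs).add
    (((contDiffAt_clm_flip hΓ).clm_apply hs).clm_comp (contDiffAt_fderiv hf))

theorem covDerivAlong_covDerivAlong (hf : ContDiffAt ℝ ∞ f y) (hs : ContDiffAt ℝ ∞ s y)
    (u v : E) : covDerivAlong G f (fun z => covDerivAlong G f s z v) y u =
      fderiv ℝ (fderiv ℝ s) y u v
        + (fderiv ℝ (christoffel G) (f y) (fderiv ℝ f y u) (fderiv ℝ f y v) (s y)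
          + christoffel G (f y) (fderiv ℝ (fderiv ℝ f) y u v) (s y)
          + christoffel G (f y) (fderiv ℝ f y v) (fderiv ℝ s y u))
        + christoffel G (f y) (fderiv ℝ f y u) (fderiv ℝ s y v
          + christoffel G (f y) (fderiv ℝ f y v) (s y)) := by
  have hdf : DifferentiableAt ℝ (fderiv ℝ f) y := (contDiffAt_fderiv hf).differentiableAt (by simp)
  have hds : DifferentiableAt ℝ (fderiv ℝ s) y := (contDiffAt_fderiv hs).differentiableAt (by simp)
  have hΓ := hG.differentiableAt_christoffel hy
  have hf' := hf.differentiableAt (by simp)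
  have hs' := hs.differentiableAt (by simp)
  have hΓs : DifferentiableAt ℝ (fun z => christoffel G (f z) (fderiv ℝ f z v) (s z)) y := by
    have : DifferentiableAt ℝ (fun z => christoffel G (f z)) y := hΓ.comp y hf'
    fun_prop
  simp only [covDerivAlong_apply]
  rw [fderiv_fun_add (by fun_prop) hΓs, add_apply,
    fderiv_clm_apply_const hds, fderiv_bilin_comp hΓ hf' (by fun_prop) hs',
    fderiv_clm_apply_const hdf]

theorem covDerivAlong_comm (hf : ContDiffAt ℝ ∞ f y) (hs : ContDiffAt ℝ ∞ s y) (u v : E) :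
    covDerivAlong G f (fun z => covDerivAlong G f s z v) y u
      - covDerivAlong G f (fun z => covDerivAlong G f s z u) y v =
    curvature G (f y) (fderiv ℝ f y u) (fderiv ℝ f y v) (s y) := by
  rw [covDerivAlong_covDerivAlong hG hy hf hs, covDerivAlong_covDerivAlong hG hy hf hs,
    hG.curvature_eq hy, fderiv_fderiv_comm hf u v, fderiv_fderiv_comm hs u v, map_add, map_add]
  abel

theorem fderiv_fderiv_inner_self (hf : ContDiffAt ℝ ∞ f y) (hs : ContDiffAt ℝ ∞ s y) (u v : E) :
    fderiv ℝ (fderiv ℝ fun z => G (f z) (s z) (s z)) y u v =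
      2 * (G (f y) (covDerivAlong G f (fun z => covDerivAlong G f s z v) y u) (s y)
        + G (f y) (covDerivAlong G f s y v) (covDerivAlong G f s y u)) := by
  have hsq : ContDiffAt ℝ ∞ (fun z => G (f z) (s z) (s z)) y :=
    (((hG.contDiffAt _ hy).comp y hf).clm_apply hs).clm_apply hs
  have hDs : DifferentiableAt ℝ (fun z => covDerivAlong G f s z v) y :=
    ((contDiffAt_covDerivAlong hG hy hf hs).differentiableAt (by simp)).clm_apply
      (differentiableAt_const v)
  have hf' := hf.differentiableAt (by simp)
  have hs' := hs.differentiableAt (by simp)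
  have hDss : DifferentiableAt ℝ (fun z => G (f z) (covDerivAlong G f s z v) (s z)) y :=
    (((hG.differentiableAt hy).comp y hf').clm_apply hDs).clm_apply hs'
  have hfirst : (fun z => fderiv ℝ (fun z => G (f z) (s z) (s z)) z v) =ᶠ[nhds y]
      fun z => 2 * G (f z) (covDerivAlong G f s z v) (s z) := by
    filter_upwards [hf.continuousAt (hG.mem_nhds hy), (hf.of_le (m := 1) (by simp)).eventually
      (by simp), (hs.of_le (m := 1) (by simp)).eventually (by simp)] with z hz hfz hsz
    have hsz' := hsz.differentiableAt one_ne_zero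
    rw [fderiv_inner_along hG hz (hfz.differentiableAt one_ne_zero) hsz' hsz', hG.symm _ hz (s z)]
    ring
  rw [← fderiv_clm_apply_const ((contDiffAt_fderiv hsq).differentiableAt (by simp)),
    hfirst.fderiv_eq, fderiv_const_mul hDss, smul_apply, smul_eq_mul,
    fderiv_inner_along hG hy hf' hDs hs']

theorem inner_curvature_along_self (hf : ContDiffAt ℝ ∞ f y) (hs : ContDiffAt ℝ ∞ s y)
    (u v : E) :
    G (f y) (curvature G (f y) (fderiv ℝ f y u) (fderiv ℝ f y v) (s y)) (s y) = 0 := by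
  have hsq : ContDiffAt ℝ ∞ (fun z => G (f z) (s z) (s z)) y :=
    (((hG.contDiffAt _ hy).comp y hf).clm_apply hs).clm_apply hs
  have h := fderiv_fderiv_comm hsq u v
  rw [fderiv_fderiv_inner_self hG hy hf hs, fderiv_fderiv_inner_self hG hy hf hs,
    hG.symm _ hy (covDerivAlong G f s y u)] at h
  rw [← covDerivAlong_comm hG hy hf hs, map_sub, sub_apply]
  linarith

end CovDerivAlong

/-! ### Constant sectional curvature -/

/-- The symmetries of the form `Q u v w z = ⟨R(u, v) w, z⟩` of a curvature tensor. The
antisymmetry in the last two arguments is encoded as `Q u v w w = 0`. -/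
structure IsAlgebraicCurvature {F : Type*} [AddCommGroup F] (Q : F → F → F → F → ℝ) : Prop where
  add₁ : ∀ u u' v w z, Q (u + u') v w z = Q u v w z + Q u' v w z
  add₂ : ∀ u v v' w z, Q u (v + v') w z = Q u v w z + Q u v' w z
  add₃ : ∀ u v w w' z, Q u v (w + w') z = Q u v w z + Q u v w' z
  add₄ : ∀ u v w z z', Q u v w (z + z') = Q u v w z + Q u v w z'
  antisymm : ∀ u v w z, Q u v w z = -Q v u w z
  self : ∀ u v w, Q u v w w = 0
  bianchi : ∀ u v w z, Q u v w z + Q v w u z + Q w u v z = 0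

namespace IsAlgebraicCurvature

variable {F : Type*} [AddCommGroup F] {Q : F → F → F → F → ℝ} (hQ : IsAlgebraicCurvature Q)

include hQ

theorem antisymm_right (u v w z : F) : Q u v w z = -Q u v z w := by
  have h := hQ.self u v (w + z)
  rw [hQ.add₃, hQ.add₄, hQ.add₄, hQ.self, hQ.self] at h
  linarith

theorem pair_symm (u v w z : F) : Q u v w z = Q w z u v := by
  linarith [hQ.bianchi u v w z, hQ.bianchi v w z u, hQ.bianchi w z u v, hQ.bianchi z u v w,
    hQ.antisymm_right v w z u, hQ.antisymm_right w z v u, hQ.antisymm z v w u,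
    hQ.antisymm z u w v, hQ.antisymm_right u z w v, hQ.antisymm u w z v,
    hQ.antisymm_right w u z v, hQ.antisymm z u v w, hQ.antisymm_right u v z w,
    hQ.antisymm_right v z u w]

theorem eq_zero_of_sectional_eq_zero (hsec : ∀ u v, Q u v v u = 0) (u v w z : F) :
    Q u v w z = 0 := by
  have outer_self : ∀ u v w, Q u v w u = 0 := by
    intro u v w
    have h := hsec u (v + w)
    rw [hQ.add₂, hQ.add₃, hQ.add₃, hsec, hsec] at h
    linarith [hQ.pair_symm u w v u, hQ.antisymm v u u w, hQ.antisymm_right u v u w]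
  have antisymm_outer : ∀ u v w z, Q u v w z = -Q z v w u := by
    intro u v w z
    have h := outer_self (u + z) v w
    rw [hQ.add₁, hQ.add₄, hQ.add₄, outer_self, outer_self] at h
    linarith
  have antisymm₁₃ : ∀ u v w z, Q u v w z = -Q w v u z := by
    intro u v w z
    linarith [antisymm_outer u v w z, hQ.antisymm_right z v w u, antisymm_outer z v u w]
  linarith [hQ.bianchi u v w z, hQ.antisymm u v w z, antisymm₁₃ v u w z, antisymm₁₃ v w u z,
    hQ.antisymm u w v z, antisymm₁₃ u v w z, hQ.antisymm w v u z]

end IsAlgebraicCurvature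

theorem bilinForm_apply_self_eq_zero {K W : Type*} [Field K] [Infinite K] [AddCommGroup W]
    [Module K W] {B B' : LinearMap.BilinForm K W} (h : ∀ u, B' u u ≠ 0 → B u u = 0) {a : W}
    (ha : B' a a ≠ 0) (u : W) : B u u = 0 := by
  open Polynomial in
  -- The restriction of a quadratic form to the line `u + t a` is a polynomial in `t`.
  let restr (D : LinearMap.BilinForm K W) : K[X] :=
    C (D u u) + C (D u a + D a u) * X + C (D a a) * X ^ 2
  have eval_restr (D : LinearMap.BilinForm K W) (t : K) :
      (restr D).eval t = D (u + t • a) (u + t • a) := by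
    simp [restr]
    ring
  have hmul : restr B * restr B' = 0 := by
    refine Polynomial.funext fun t => ?_
    rw [Polynomial.eval_mul, eval_restr, eval_restr, Polynomial.eval_zero, mul_eq_zero,
      or_iff_not_imp_right]
    exact h _
  have hB' : restr B' ≠ 0 := fun h0 => ha <| by
    simpa [restr] using congrArg (fun r => Polynomial.coeff r 2) h0
  have hB : restr B = 0 := (mul_eq_zero.1 hmul).resolve_right hB'
  simpa [hB] using (eval_restr B 0).symm

/-- The curvature tensor of the metric `G` on `V` is that of a space form of curvature `c`. -/
def HasConstantCurvature (G : F → F →L[ℝ] F →L[ℝ] ℝ) (V : Set F) (c : ℝ) : Prop :=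
  ∀ z ∈ V, ∀ u v w, curvature G z u v w = c • (G z v w • u - G z u w • v)

namespace IsLocalMetric

variable (hG : IsLocalMetric G V) {z : F} (hz : z ∈ V)

include hG hz

theorem exists_nondegenerate_plane (hdim : 2 ≤ Module.finrank ℝ F) {v : F} (hv : v ≠ 0) :
    ∃ a, G z a a * G z v v - G z a v ^ 2 ≠ 0 := by
  by_contra! hdeg
  by_cases hvv : G z v v = 0
  · refine hv (hG.nondegenerate z hz v fun a => ?_)
    have hav := hdeg a
    rw [hvv, mul_zero, zero_sub, neg_eq_zero, sq_eq_zero_iff] at hav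
    rw [hG.symm z hz, hav]
  · obtain ⟨w, hw⟩ : ∃ w, w ∉ Submodule.span ℝ {v} := by
      by_contra! hall
      have hrank := finrank_span_singleton (K := ℝ) hv
      rw [(Submodule.eq_top_iff'.2 hall), finrank_top] at hrank
      omega
    set a := w - (G z w v / G z v v) • v with ha
    have hav : G z a v = 0 := by
      simp [ha, div_mul_cancel₀ _ hvv]
    have hab : ∀ b, G z a b * G z v v = 0 := by
      intro b
      have haa := hdeg a
      have hbb := hdeg b
      have hsum := hdeg (a + b)
      simp only [map_add, add_apply, hav, hG.symm z hz b a] at haa hbb hsum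
      linarith
    have ha0 : a = 0 := hG.nondegenerate z hz a fun b => by simpa [hvv] using hab b
    refine hw (Submodule.mem_span_singleton.2 ⟨_, (sub_eq_zero.1 (ha.symm.trans ha0)).symm⟩)

variable [FiniteDimensional ℝ F]

theorem inner_curvature_self (u v w : F) : G z (curvature G z u v w) w = 0 := by
  simpa using inner_curvature_along_self hG hz contDiffAt_id (contDiffAt_const (c := w)) u v

theorem inner_curvature_of_sectional (hdim : 2 ≤ Module.finrank ℝ F) {c : ℝ}
    (h : ∀ u v, G z u u * G z v v - G z u v ^ 2 ≠ 0 →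
      G z (curvature G z u v v) u / (G z u u * G z v v - G z u v ^ 2) = c) (u v : F) :
    G z (curvature G z u v v) u = c * (G z u u * G z v v - G z u v ^ 2) := by
  rcases eq_or_ne v 0 with rfl | hv
  · simp [hG.curvature_eq hz]
  obtain ⟨a, ha⟩ := hG.exists_nondegenerate_plane hz hdim hv
  let R : LinearMap.BilinForm ℝ F := LinearMap.mk₂ ℝ (fun x y => G z (curvature G z x v v) y)
    (by intros; simp only [hG.curvature_eq hz, map_add, map_sub, add_apply, sub_apply]; ring)
    (by
      intros
      simp only [hG.curvature_eq hz, map_add, map_smul, map_sub, add_apply, sub_apply,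
        smul_apply, smul_eq_mul]
      ring)
    (by intros; simp only [map_add]) (by intros; simp only [map_smul])
  let Δ : LinearMap.BilinForm ℝ F := LinearMap.mk₂ ℝ
    (fun x y => G z x y * G z v v - G z x v * G z y v)
    (by intros; simp only [map_add, add_apply]; ring)
    (by intros; simp only [map_smul, smul_apply, smul_eq_mul]; ring)
    (by intros; simp only [map_add, add_apply]; ring)
    (by intros; simp only [map_smul, smul_apply, smul_eq_mul]; ring)
  have hR : ∀ x y, R x y = G z (curvature G z x v v) y := fun x y => rfl
  have hΔ : ∀ x, Δ x x = G z x x * G z v v - G z x v ^ 2 := fun x => by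
    rw [sq, LinearMap.mk₂_apply]
  have key := bilinForm_apply_self_eq_zero (B := R - c • Δ) (B' := Δ)
    (fun x hx => by
      rw [hΔ] at hx
      simp only [LinearMap.sub_apply, LinearMap.smul_apply, smul_eq_mul, hR, hΔ,
        (div_eq_iff hx).1 (h x v hx), sub_self])
    (by rwa [hΔ]) u
  simpa only [LinearMap.sub_apply, LinearMap.smul_apply, smul_eq_mul, hR, hΔ, sub_eq_zero] using key

theorem curvature_eq_of_sectional (hdim : 2 ≤ Module.finrank ℝ F) {c : ℝ}
    (h : ∀ u v, G z u u * G z v v - G z u v ^ 2 ≠ 0 →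
      G z (curvature G z u v v) u / (G z u u * G z v v - G z u v ^ 2) = c) (u v w : F) :
    curvature G z u v w = c • (G z v w • u - G z u w • v) := by
  have hQ : IsAlgebraicCurvature fun u v w x =>
      G z (curvature G z u v w) x - c * (G z v w * G z u x - G z u w * G z v x) :=
    { add₁ := by
        intros
        simp only [hG.curvature_eq hz, map_add, map_sub, add_apply, sub_apply]
        ring
      add₂ := by
        intros
        simp only [hG.curvature_eq hz, map_add, map_sub, add_apply, sub_apply]
        ring
      add₃ := by
        intros
        simp only [hG.curvature_eq hz, map_add, map_sub, add_apply, sub_apply]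
        ring
      add₄ := by intros; simp only [map_add]; ring
      antisymm := by intro u v w x; rw [curvature_antisymm G z u v w, map_neg, neg_apply]; ring
      self := by intro u v w; rw [hG.inner_curvature_self hz]; ring
      bianchi := by
        intro u v w x
        have hB := congrArg (fun r => G z r x) (hG.curvature_bianchi hz u v w)
        simp only [map_add, add_apply, map_zero, zero_apply] at hB
        rw [hG.symm z hz v w, hG.symm z hz u w, hG.symm z hz u v]
        linarith }
  refine hG.ext_inner hz fun x => ?_
  have key := hQ.eq_zero_of_sectional_eq_zero (fun u v => by
    rw [hG.inner_curvature_of_sectional hz hdim h, hG.symm z hz v u]; ring) u v w x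
  simp only [map_sub, map_smul, sub_apply, smul_apply, smul_eq_mul]
  linarith

end IsLocalMetric

/-! ### Hypersurfaces in coordinates -/

variable {f ν : E → F} {U : Set E} {ε : ℝ}

/-- `f` is a hypersurface of `(V, G)` parametrized by the open set `U`, with nondegenerate induced
metric and with unit normal field `ν` of causal character `ε`. -/
structure IsLocalHypersurface (G : F → F →L[ℝ] F →L[ℝ] ℝ) (V : Set F) (f ν : E → F) (U : Set E)
    (ε : ℝ) : Prop where
  metric : IsLocalMetric G V
  isOpen : IsOpen U
  mapsTo : Set.MapsTo f U V
  contDiffAt_map : ∀ y ∈ U, ContDiffAt ℝ ∞ f y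
  contDiffAt_normal : ∀ y ∈ U, ContDiffAt ℝ ∞ ν y
  normal : ∀ y ∈ U, ∀ u, G (f y) (ν y) (fderiv ℝ f y u) = 0
  inner_self : ∀ y ∈ U, G (f y) (ν y) (ν y) = ε
  sign : ε = 1 ∨ ε = -1
  nondegenerate : ∀ y ∈ U, ∀ u, (∀ v, pullbackMetric G f y u v = 0) → u = 0
  finrank_eq : Module.finrank ℝ F = Module.finrank ℝ E + 1

/-- The covariant derivative `∇A` of a field of endomorphisms `A`, for the connection with
Christoffel symbols `Γ`; `covDerivEnd Γ A y u` is `∇_u A`. -/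
def covDerivEnd (Γ : E → E →L[ℝ] E →L[ℝ] E) (A : E → E →L[ℝ] E) (y : E) :
    E →L[ℝ] E →L[ℝ] E :=
  fderiv ℝ A y + ContinuousLinearMap.postcomp E (A y) ∘L (-Γ y)
    + ContinuousLinearMap.precomp E (A y) ∘L Γ y

theorem covDerivEnd_apply (Γ : E → E →L[ℝ] E →L[ℝ] E) (A : E → E →L[ℝ] E) (y u : E) :
    covDerivEnd Γ A y u = fderiv ℝ A y u + Γ y u * A y - A y * Γ y u := by
  ext v
  simp [covDerivEnd]
  abel

namespace IsLocalHypersurface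

variable (hf : IsLocalHypersurface G V f ν U ε)

include hf

theorem sign_mul_self : ε * ε = 1 := by
  rcases hf.sign with h | h <;> simp [h]

theorem sign_ne_zero : ε ≠ 0 :=
  left_ne_zero_of_mul_eq_one hf.sign_mul_self

theorem isLocalMetric_pullbackMetric : IsLocalMetric (pullbackMetric G f) U where
  isOpen := hf.isOpen
  contDiffAt y hy :=
    contDiffAt_pullbackMetric (hf.metric.contDiffAt _ (hf.mapsTo hy)) (hf.contDiffAt_map y hy)
  symm _ hy _ _ := hf.metric.symm _ (hf.mapsTo hy) _ _
  nondegenerate := hf.nondegenerate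

variable {y : E} (hy : y ∈ U)

include hy

theorem mem_nhds : U ∈ nhds y :=
  hf.isOpen.mem_nhds hy

theorem differentiableAt_map : DifferentiableAt ℝ f y :=
  (hf.contDiffAt_map y hy).differentiableAt (by simp)

theorem differentiableAt_normal : DifferentiableAt ℝ ν y :=
  (hf.contDiffAt_normal y hy).differentiableAt (by simp)

theorem differentiableAt_fderiv : DifferentiableAt ℝ (fderiv ℝ f) y :=
  (contDiffAt_fderiv (hf.contDiffAt_map y hy)).differentiableAt (by simp)

theorem inner_fderiv_normal (u : E) : G (f y) (fderiv ℝ f y u) (ν y) = 0 := by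
  rw [hf.metric.symm _ (hf.mapsTo hy), hf.normal y hy]

theorem fderiv_injective : Function.Injective (fderiv ℝ f y) :=
  (injective_iff_map_eq_zero _).2 fun v hv =>
    hf.nondegenerate y hy v fun w => by simp [pullbackMetric_apply, hv]

theorem covDerivAlong_fderiv (u v : E) :
    covDerivAlong G f (fun z => fderiv ℝ f z v) y u =
      fderiv ℝ (fderiv ℝ f) y u v
        + christoffel G (f y) (fderiv ℝ f y u) (fderiv ℝ f y v) := by
  rw [covDerivAlong_apply, fderiv_clm_apply_const (hf.differentiableAt_fderiv hy)]

theorem inner_shapeOp [FiniteDimensional ℝ E] (u v : E) :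
    pullbackMetric G f y (shapeOp G f ν y u) v =
      -G (f y) (covDerivAlong G f ν y u) (fderiv ℝ f y v) := by
  simp [shapeOp, (hf.isLocalMetric_pullbackMetric.isInvertible hy).self_apply_inverse]

variable [FiniteDimensional ℝ F]

theorem exists_eq_tangent_add_normal [FiniteDimensional ℝ E] (b : F) :
    ∃ (v : E) (t : ℝ), b = fderiv ℝ f y v + t • ν y := by
  let L : E × ℝ →ₗ[ℝ] F := (fderiv ℝ f y).toLinearMap.coprod (LinearMap.toSpanSingleton ℝ F (ν y))
  have hL : ∀ v t, L (v, t) = fderiv ℝ f y v + t • ν y := fun v t => by simp [L]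
  have hinj : Function.Injective L := by
    rw [injective_iff_map_eq_zero]
    rintro ⟨v, t⟩ hvt
    rw [hL] at hvt
    obtain rfl : t = 0 := by
      have := congrArg (G (f y) (ν y)) hvt
      simpa [hf.normal y hy, hf.inner_self y hy, hf.sign_ne_zero] using this
    obtain rfl : v = 0 := by
      rw [zero_smul, add_zero] at hvt
      exact hf.fderiv_injective hy (hvt.trans (map_zero _).symm)
    rfl
  have hsurj : Function.Surjective L := by
    rwa [← LinearMap.injective_iff_surjective_of_finrank_eq_finrank]
    rw [hf.finrank_eq, Module.finrank_prod, Module.finrank_self]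
  obtain ⟨⟨v, t⟩, rfl⟩ := hsurj b
  exact ⟨v, t, hL v t⟩

theorem eq_of_inner [FiniteDimensional ℝ E] {a b : F}
    (htan : ∀ w, G (f y) a (fderiv ℝ f y w) = G (f y) b (fderiv ℝ f y w))
    (hnor : G (f y) a (ν y) = G (f y) b (ν y)) : a = b :=
  hf.metric.ext_inner (hf.mapsTo hy) fun x => by
    obtain ⟨v, t, rfl⟩ := hf.exists_eq_tangent_add_normal hy x
    simp only [map_add, map_smul, htan, hnor]

theorem inner_covDerivAlong_normal_self (u : E) :
    G (f y) (covDerivAlong G f ν y u) (ν y) = 0 := by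
  have hν := hf.differentiableAt_normal hy
  have hderiv := fderiv_inner_along hf.metric (hf.mapsTo hy) (hf.differentiableAt_map hy) hν hν u
  have hconst : (fun z => G (f z) (ν z) (ν z)) =ᶠ[nhds y] fun _ => ε :=
    Filter.mem_of_superset (hf.mem_nhds hy) fun z hz => hf.inner_self z hz
  rw [hconst.fderiv_eq, hf.metric.symm _ (hf.mapsTo hy) (ν y), fderiv_fun_const, Pi.zero_apply,
    zero_apply] at hderiv
  linarith

variable [FiniteDimensional ℝ E]

theorem weingarten_formula (u : E) :
    covDerivAlong G f ν y u = -fderiv ℝ f y (shapeOp G f ν y u) := by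
  refine hf.eq_of_inner hy (fun w => ?_) ?_
  · rw [map_neg, neg_apply, ← pullbackMetric_apply, hf.inner_shapeOp hy, neg_neg]
  · rw [hf.inner_covDerivAlong_normal_self hy, map_neg, neg_apply, hf.inner_fderiv_normal hy,
      neg_zero]

theorem inner_covDerivAlong_fderiv_normal (u v : E) :
    G (f y) (covDerivAlong G f (fun z => fderiv ℝ f z v) y u) (ν y) =
      pullbackMetric G f y (shapeOp G f ν y u) v := by
  have hdf := hf.differentiableAt_fderiv hy
  have hderiv := fderiv_inner_along (t := fun z => fderiv ℝ f z v) hf.metric (hf.mapsTo hy)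
    (hf.differentiableAt_map hy) (hf.differentiableAt_normal hy) (by fun_prop) u
  have hzero : (fun z => G (f z) (ν z) (fderiv ℝ f z v)) =ᶠ[nhds y] fun _ => 0 :=
    Filter.mem_of_superset (hf.mem_nhds hy) fun z hz => hf.normal z hz v
  rw [hzero.fderiv_eq, hf.metric.symm _ (hf.mapsTo hy) (ν y), fderiv_fun_const, Pi.zero_apply,
    zero_apply] at hderiv
  rw [hf.inner_shapeOp hy]
  linarith

theorem gauss_formula (u v : E) :
    covDerivAlong G f (fun z => fderiv ℝ f z v) y u =
      fderiv ℝ f y (christoffel (pullbackMetric G f) y u v)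
        + (ε * pullbackMetric G f y (shapeOp G f ν y u) v) • ν y := by
  refine hf.eq_of_inner hy (fun w => ?_) ?_
  · have h := hf.isLocalMetric_pullbackMetric.inner_christoffel hy u v w
    rw [pullbackMetric_apply, koszul_pullbackMetric hf.metric (hf.mapsTo hy)
      (hf.contDiffAt_map y hy), ← hf.metric.inner_christoffel (hf.mapsTo hy)] at h
    simp only [hf.covDerivAlong_fderiv hy, map_add, add_apply, map_smul, smul_apply, h,
      hf.normal y hy, smul_eq_mul]
    ring
  · rw [hf.inner_covDerivAlong_fderiv_normal hy]
    simp only [map_add, add_apply, map_smul, smul_apply, hf.inner_fderiv_normal hy,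
      hf.inner_self y hy, smul_eq_mul]
    linear_combination (-pullbackMetric G f y (shapeOp G f ν y u) v) * hf.sign_mul_self

theorem inner_shapeOp_comm (u v : E) :
    pullbackMetric G f y (shapeOp G f ν y u) v = pullbackMetric G f y u (shapeOp G f ν y v) := by
  rw [hf.isLocalMetric_pullbackMetric.symm y hy u, ← hf.inner_covDerivAlong_fderiv_normal hy,
    ← hf.inner_covDerivAlong_fderiv_normal hy, hf.covDerivAlong_fderiv hy,
    hf.covDerivAlong_fderiv hy, fderiv_fderiv_comm (hf.contDiffAt_map y hy),
    hf.metric.christoffel_symm (hf.mapsTo hy)]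

theorem contDiffAt_shapeOp : ContDiffAt ℝ ∞ (shapeOp G f ν) y := by
  have hf' := hf.contDiffAt_map y hy
  have hν := contDiffAt_covDerivAlong hf.metric (hf.mapsTo hy) hf' (hf.contDiffAt_normal y hy)
  have hG : ContDiffAt ℝ ∞ (fun z => G (f z)) y :=
    (hf.metric.contDiffAt _ (hf.mapsTo hy)).comp y hf'
  exact (hf.isLocalMetric_pullbackMetric.contDiffAt_inverse hy).clm_comp
    (contDiffAt_bilinearComp hG hν (contDiffAt_fderiv hf')).neg

theorem differentiableAt_shapeOp : DifferentiableAt ℝ (shapeOp G f ν) y :=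
  (hf.contDiffAt_shapeOp hy).differentiableAt (by simp)

theorem covDerivAlong_tangential {X : E → E} (hX : DifferentiableAt ℝ X y) (u : E) :
    covDerivAlong G f (fun z => fderiv ℝ f z (X z)) y u =
      fderiv ℝ f y (fderiv ℝ X y u + christoffel (pullbackMetric G f) y u (X y))
        + (ε * pullbackMetric G f y (shapeOp G f ν y u) (X y)) • ν y := by
  have hgauss := hf.gauss_formula hy u (X y)
  rw [hf.covDerivAlong_fderiv hy] at hgauss
  rw [covDerivAlong_apply, fderiv_clm_apply (hf.differentiableAt_fderiv hy) hX, map_add, add_assoc,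
    ← hgauss, add_apply, ContinuousLinearMap.comp_apply, ContinuousLinearMap.flip_apply]
  abel

theorem covDerivAlong_covDerivAlong_normal (u v : E) :
    covDerivAlong G f (fun z => covDerivAlong G f ν z v) y u =
      -(fderiv ℝ f y (fderiv ℝ (shapeOp G f ν) y u v
          + christoffel (pullbackMetric G f) y u (shapeOp G f ν y v))
        + (ε * pullbackMetric G f y (shapeOp G f ν y u) (shapeOp G f ν y v)) • ν y) := by
  have hA := hf.differentiableAt_shapeOp hy
  have hweingarten : (fun z => covDerivAlong G f ν z v) =ᶠ[nhds y]
      fun z => -(fun z => fderiv ℝ f z (shapeOp G f ν z v)) z :=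
    Filter.mem_of_superset (hf.mem_nhds hy) fun z hz => hf.weingarten_formula hz v
  rw [covDerivAlong_congr hweingarten, covDerivAlong_neg, neg_apply, ← fderiv_clm_apply_const hA,
    hf.covDerivAlong_tangential hy (X := fun z => shapeOp G f ν z v) (by fun_prop)]

theorem inner_covDerivAlong_covDerivAlong_fderiv (u v w d : E) :
    G (f y) (covDerivAlong G f (fun z => covDerivAlong G f (fun z => fderiv ℝ f z w) z v) y u)
        (fderiv ℝ f y d) =
      pullbackMetric G f y (fderiv ℝ (christoffel (pullbackMetric G f)) y u v w
        + christoffel (pullbackMetric G f) y u (christoffel (pullbackMetric G f) y v w)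
        - (ε * pullbackMetric G f y (shapeOp G f ν y v) w) • shapeOp G f ν y u) d := by
  have hΓ := hf.isLocalMetric_pullbackMetric.differentiableAt_christoffel hy
  have hA := hf.differentiableAt_shapeOp hy
  have hh := hf.isLocalMetric_pullbackMetric.differentiableAt hy
  have hν := hf.differentiableAt_normal hy
  have hdf := hf.differentiableAt_fderiv hy
  have hgauss : (fun z => covDerivAlong G f (fun z => fderiv ℝ f z w) z v) =ᶠ[nhds y] fun z =>
      fderiv ℝ f z (christoffel (pullbackMetric G f) z v w)
        + (ε * pullbackMetric G f z (shapeOp G f ν z v) w) • ν z :=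
    Filter.mem_of_superset (hf.mem_nhds hy) fun z hz => hf.gauss_formula hz v w
  rw [covDerivAlong_congr hgauss, covDerivAlong_add (by fun_prop) (by fun_prop), add_apply,
    hf.covDerivAlong_tangential hy (by fun_prop), covDerivAlong_smul (by fun_prop) hν,
    hf.weingarten_formula hy, fderiv_clm_apply₂_const hΓ]
  simp only [map_add, add_apply, map_smul, smul_apply, hf.normal y hy, map_neg, neg_apply,
    pullbackMetric_apply, map_sub, sub_apply, smul_eq_mul]
  ring

variable {c : ℝ} (hc : HasConstantCurvature G V c)

include hc

theorem codazzi_equation (u v : E) :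
    covDerivEnd (christoffel (pullbackMetric G f)) (shapeOp G f ν) y u v =
      covDerivEnd (christoffel (pullbackMetric G f)) (shapeOp G f ν) y v u := by
  have hcomm := covDerivAlong_comm hf.metric (hf.mapsTo hy) (hf.contDiffAt_map y hy)
    (hf.contDiffAt_normal y hy) u v
  rw [hc _ (hf.mapsTo hy), hf.inner_fderiv_normal hy, hf.inner_fderiv_normal hy,
    hf.covDerivAlong_covDerivAlong_normal hy, hf.covDerivAlong_covDerivAlong_normal hy,
    hf.isLocalMetric_pullbackMetric.symm y hy (shapeOp G f ν y v),
    zero_smul, zero_smul, sub_zero, smul_zero] at hcomm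
  have htan : fderiv ℝ (shapeOp G f ν) y u v
        + christoffel (pullbackMetric G f) y u (shapeOp G f ν y v)
      = fderiv ℝ (shapeOp G f ν) y v u
        + christoffel (pullbackMetric G f) y v (shapeOp G f ν y u) :=
    hf.fderiv_injective hy (add_right_cancel (neg_injective (sub_eq_zero.1 hcomm)))
  simp only [covDerivEnd_apply, sub_apply, add_apply, ContinuousLinearMap.mul_def,
    ContinuousLinearMap.comp_apply, htan,
    hf.isLocalMetric_pullbackMetric.christoffel_symm hy u v]

theorem gauss_equation (u v w : E) :
    curvature (pullbackMetric G f) y u v w =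
      c • (pullbackMetric G f y v w • u - pullbackMetric G f y u w • v)
        + ε • (pullbackMetric G f y (shapeOp G f ν y v) w • shapeOp G f ν y u
          - pullbackMetric G f y (shapeOp G f ν y u) w • shapeOp G f ν y v) := by
  have hcomm := covDerivAlong_comm (s := fun z => fderiv ℝ f z w) hf.metric (hf.mapsTo hy)
    (hf.contDiffAt_map y hy)
    ((contDiffAt_fderiv (hf.contDiffAt_map y hy)).clm_apply contDiffAt_const) u v
  rw [hc _ (hf.mapsTo hy)] at hcomm
  refine hf.isLocalMetric_pullbackMetric.ext_inner hy fun d => ?_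
  have hinner := congrArg (fun a => G (f y) a (fderiv ℝ f y d)) hcomm
  simp only [map_sub, sub_apply, hf.inner_covDerivAlong_covDerivAlong_fderiv hy, map_smul,
    smul_apply, smul_eq_mul, map_add, add_apply, ← pullbackMetric_apply] at hinner
  rw [hf.isLocalMetric_pullbackMetric.curvature_eq hy]
  simp only [map_sub, sub_apply, map_smul, smul_apply, smul_eq_mul, map_add, add_apply]
  linarith

end IsLocalHypersurface

end LocalHypersurface

/-! ### Traces and the Laplacian -/

section Trace

variable {m : ℕ}

theorem trace_eq_sum_single (B : Coord m →ₗ[ℝ] Coord m) :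
    LinearMap.trace ℝ (Coord m) B = ∑ i, B (EuclideanSpace.single i 1) i := by
  rw [LinearMap.trace_eq_sum_inner B (EuclideanSpace.basisFun (Fin m) ℝ)]
  simp [EuclideanSpace.inner_single_left]

theorem sum_coord_smul_single (x : Coord m) : ∑ j, x j • EuclideanSpace.single j (1 : ℝ) = x := by
  simpa using (EuclideanSpace.basisFun (Fin m) ℝ).sum_repr x

variable {h : Coord m →L[ℝ] Coord m →L[ℝ] ℝ} (hs : ∀ u v, h u v = h v u)
  (hn : ∀ u, (∀ v, h u v = 0) → u = 0)

include hs hn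

theorem sum_invEntry_mul (B : Coord m →L[ℝ] Coord m) :
    ∑ i, ∑ j, invEntry h i j * h (B (EuclideanSpace.single i 1)) (EuclideanSpace.single j 1) =
      LinearMap.trace ℝ (Coord m) B := by
  rw [trace_eq_sum_single]
  refine Finset.sum_congr rfl fun i _ => ?_
  have hcoord : h (B (EuclideanSpace.single i 1)) (h.inverse (EuclideanSpace.proj i)) =
      B (EuclideanSpace.single i 1) i := by
    rw [hs, (isInvertible_of_nondegenerate hn).self_apply_inverse]
    simp
  rw [ContinuousLinearMap.coe_coe, ← hcoord]
  conv_rhs => rw [← sum_coord_smul_single (h.inverse (EuclideanSpace.proj i))]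
  simp [invEntry]

theorem sum_invEntry_mul_left (φ : Coord m →L[ℝ] ℝ) (x : Coord m) :
    ∑ i, ∑ j, invEntry h i j * (φ (EuclideanSpace.single i 1) * h x (EuclideanSpace.single j 1)) =
      φ x := by
  have htrace := sum_invEntry_mul hs hn (φ.smulRight x)
  simp only [ContinuousLinearMap.smulRight_apply, map_smul, smul_apply, smul_eq_mul] at htrace
  rw [htrace]
  exact LinearMap.trace_smulRight φ.toLinearMap x

theorem sum_invEntry_mul_right (φ : Coord m →L[ℝ] ℝ) (x : Coord m) :
    ∑ i, ∑ j, invEntry h i j * (φ (EuclideanSpace.single j 1) * h x (EuclideanSpace.single i 1)) =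
      φ x := by
  have hφ := (isInvertible_of_nondegenerate hn).self_apply_inverse φ
  have htrace := sum_invEntry_mul hs hn ((h x).smulRight (h.inverse φ))
  simp only [ContinuousLinearMap.smulRight_apply, map_smul, smul_apply, smul_eq_mul, hφ] at htrace
  simp only [mul_comm (φ _), htrace]
  refine (LinearMap.trace_smulRight (h x).toLinearMap (h.inverse φ)).trans ?_
  rw [ContinuousLinearMap.coe_coe, hs, hφ]

end Trace

section CovDerivEnd

variable {E : Type*} [NormedAddCommGroup E] [NormedSpace ℝ E]

theorem trace_covDerivEnd (Γ : E → E →L[ℝ] E →L[ℝ] E) (A : E → E →L[ℝ] E) (y u : E) :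
    LinearMap.trace ℝ E (covDerivEnd Γ A y u) = LinearMap.trace ℝ E (fderiv ℝ A y u) := by
  have hcomm : LinearMap.trace ℝ E (Γ y u * A y : E →L[ℝ] E) =
      LinearMap.trace ℝ E (A y * Γ y u : E →L[ℝ] E) :=
    LinearMap.trace_mul_comm ℝ (Γ y u).toLinearMap (A y).toLinearMap
  rw [covDerivEnd_apply, ContinuousLinearMap.toLinearMap_sub, ContinuousLinearMap.toLinearMap_add,
    map_sub, map_add, hcomm, add_sub_cancel_right]

theorem IsLocalMetric.inner_covDerivEnd_comm [FiniteDimensional ℝ E]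
    {h : E → E →L[ℝ] E →L[ℝ] ℝ} {U : Set E} (hh : IsLocalMetric h U) {A : E → E →L[ℝ] E}
    (hsa : ∀ y ∈ U, ∀ v w, h y (A y v) w = h y v (A y w)) {y : E} (hy : y ∈ U)
    (hA : DifferentiableAt ℝ A y) (u v w : E) :
    h y (covDerivEnd (christoffel h) A y u v) w =
      h y v (covDerivEnd (christoffel h) A y u w) := by
  have hd := hh.differentiableAt hy
  have hleft := fderiv_bilin_comp (f := fun z => z) (s := fun z => A z v)
    (t := fun _ => w) hd (by fun_prop) (by fun_prop) (by fun_prop) u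
  have hright := fderiv_bilin_comp (f := fun z => z) (s := fun _ => v)
    (t := fun z => A z w) hd (by fun_prop) (by fun_prop) (by fun_prop) u
  have hcongr : (fun z => h z (A z v) w) =ᶠ[nhds y] fun z => h z v (A z w) := by
    filter_upwards [hh.mem_nhds hy] with z hz using hsa z hz v w
  rw [hcongr.fderiv_eq, hright] at hleft
  simp only [hh.fderiv_eq_christoffel hy, fderiv_clm_apply_const hA, fderiv_fun_id,
    fderiv_fun_const, ContinuousLinearMap.coe_id', id_eq, Pi.zero_apply, zero_apply, map_zero,
    add_zero] at hleft
  simp only [covDerivEnd_apply, map_sub, map_add, sub_apply, add_apply,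
    ContinuousLinearMap.mul_def, ContinuousLinearMap.comp_apply, hsa y hy (christoffel h y u v),
    ← hsa y hy v]
  linarith

end CovDerivEnd

namespace IsLocalHypersurface

section General

variable {E F : Type*} [NormedAddCommGroup E] [NormedSpace ℝ E]
  [NormedAddCommGroup F] [NormedSpace ℝ F] [FiniteDimensional ℝ E] [FiniteDimensional ℝ F]
  {G : F → F →L[ℝ] F →L[ℝ] ℝ} {V : Set F} {f ν : E → F} {U : Set E} {ε : ℝ}
  (hf : IsLocalHypersurface G V f ν U ε) {y : E} (hy : y ∈ U)

include hf hy

theorem covDerivAlong_covDerivAlong_smul_normal {φ : E → ℝ} (hφ : ∀ z ∈ U, ContDiffAt ℝ ∞ φ z)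
    (u v : E) :
    covDerivAlong G f (fun z => covDerivAlong G f (fun z => φ z • ν z) z v) y u
        - covDerivAlong G f (fun z => φ z • ν z) y (christoffel (pullbackMetric G f) y u v) =
      (fderiv ℝ (fderiv ℝ φ) y u v - fderiv ℝ φ y (christoffel (pullbackMetric G f) y u v)
          - ε * φ y * pullbackMetric G f y (shapeOp G f ν y u) (shapeOp G f ν y v)) • ν y
        - fderiv ℝ f y (fderiv ℝ φ y u • shapeOp G f ν y v + fderiv ℝ φ y v • shapeOp G f ν y u
          + φ y • covDerivEnd (christoffel (pullbackMetric G f)) (shapeOp G f ν) y u v) := by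
  have hd : ∀ z ∈ U, DifferentiableAt ℝ φ z := fun z hz =>
    (hφ z hz).differentiableAt (by simp)
  have hdd : DifferentiableAt ℝ (fderiv ℝ φ) y :=
    (contDiffAt_fderiv (hφ y hy)).differentiableAt (by simp)
  have hφy := hd y hy
  have hν := hf.differentiableAt_normal hy
  have hDν : DifferentiableAt ℝ (covDerivAlong G f ν) y :=
    (contDiffAt_covDerivAlong hf.metric (hf.mapsTo hy) (hf.contDiffAt_map y hy)
      (hf.contDiffAt_normal y hy)).differentiableAt (by simp)
  have hleibniz : (fun z => covDerivAlong G f (fun z => φ z • ν z) z v) =ᶠ[nhds y]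
      fun z => fderiv ℝ φ z v • ν z + φ z • covDerivAlong G f ν z v := by
    filter_upwards [hf.mem_nhds hy] with z hz using
      covDerivAlong_smul (hd z hz) (hf.differentiableAt_normal hz) v
  rw [covDerivAlong_congr hleibniz, covDerivAlong_add (by fun_prop) (by fun_prop), add_apply,
    covDerivAlong_smul (by fun_prop) hν, covDerivAlong_smul hφy (by fun_prop),
    covDerivAlong_smul hφy hν, hf.covDerivAlong_covDerivAlong_normal hy,
    hf.weingarten_formula hy, hf.weingarten_formula hy, hf.weingarten_formula hy,
    fderiv_clm_apply_const hdd, covDerivEnd_apply]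
  simp only [map_add, map_sub, map_smul, sub_apply, add_apply, ContinuousLinearMap.mul_def,
    ContinuousLinearMap.comp_apply]
  module

theorem inner_covDerivEnd_shapeOp {c : ℝ} (hc : HasConstantCurvature G V c) (u v w : E) :
    pullbackMetric G f y (covDerivEnd (christoffel (pullbackMetric G f)) (shapeOp G f ν) y u v) w =
      pullbackMetric G f y
        (covDerivEnd (christoffel (pullbackMetric G f)) (shapeOp G f ν) y w u) v := by
  have hh := hf.isLocalMetric_pullbackMetric
  rw [hh.inner_covDerivEnd_comm (fun z hz => hf.inner_shapeOp_comm hz) hy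
    (hf.differentiableAt_shapeOp hy), hf.codazzi_equation hy hc u w, hh.symm y hy]

end General

variable {m n : ℕ} {G : Coord n → Coord n →L[ℝ] Coord n →L[ℝ] ℝ} {V : Set (Coord n)}
  {f ν : Coord m → Coord n} {U : Set (Coord m)} {ε : ℝ}
  (hf : IsLocalHypersurface G V f ν U ε) {y : Coord m} (hy : y ∈ U)
  {φ : Coord m → ℝ} (hφ : ∀ z ∈ U, ContDiffAt ℝ ∞ φ z)

include hf hy hφ

theorem inner_laplacian_smul_normal_fderiv {c : ℝ} (hc : HasConstantCurvature G V c)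
    (w : Coord m) :
    G (f y) (laplacian G f (fun z => φ z • ν z) y) (fderiv ℝ f y w) =
      2 * fderiv ℝ φ y (shapeOp G f ν y w)
        + φ y * LinearMap.trace ℝ (Coord m) (fderiv ℝ (shapeOp G f ν) y w) := by
  have hh := hf.isLocalMetric_pullbackMetric
  have hs := hh.symm y hy
  have hn := hh.nondegenerate y hy
  have hsymm : ∀ u, pullbackMetric G f y (shapeOp G f ν y u) w =
      pullbackMetric G f y (shapeOp G f ν y w) u := fun u => by
    rw [hf.inner_shapeOp_comm hy, hs]
  rw [laplacian, ← trace_covDerivEnd (christoffel (pullbackMetric G f)),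
    ← sum_invEntry_mul hs hn, ← sum_invEntry_mul_left hs hn, two_mul]
  nth_rw 2 [sum_invEntry_mul_left hs hn]
  rw [← sum_invEntry_mul_right hs hn]
  simp only [hf.covDerivAlong_covDerivAlong_smul_normal hy hφ, ← Finset.sum_neg_distrib,
    Finset.mul_sum, ← Finset.sum_add_distrib, map_sum, map_neg, map_smul, sum_apply, neg_apply,
    smul_apply, map_sub, sub_apply, hf.normal y hy]
  refine Finset.sum_congr rfl fun i _ => Finset.sum_congr rfl fun j _ => ?_
  rw [← pullbackMetric_apply]
  simp only [map_add, add_apply, map_smul, smul_apply, smul_eq_mul, hsymm,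
    hf.inner_covDerivEnd_shapeOp hy hc _ _ w]
  ring

theorem inner_laplacian_smul_normal_normal (hconst : fderiv ℝ φ =ᶠ[nhds y] 0) :
    G (f y) (laplacian G f (fun z => φ z • ν z) y) (ν y) =
      φ y * LinearMap.trace ℝ (Coord m) (shapeOp G f ν y ∘L shapeOp G f ν y).toLinearMap := by
  have hh := hf.isLocalMetric_pullbackMetric
  rw [laplacian, ← sum_invEntry_mul (hh.symm y hy) (hh.nondegenerate y hy)]
  simp only [hf.covDerivAlong_covDerivAlong_smul_normal hy hφ, ← Finset.sum_neg_distrib,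
    Finset.mul_sum, map_sum, map_neg, map_smul, sum_apply, neg_apply, smul_apply, map_sub,
    sub_apply, hf.inner_self y hy, hf.inner_fderiv_normal hy, hconst.fderiv_eq, hconst.eq_of_nhds]
  refine Finset.sum_congr rfl fun i _ => Finset.sum_congr rfl fun j _ => ?_
  rw [ContinuousLinearMap.comp_apply, hf.inner_shapeOp_comm hy (shapeOp G f ν y _)]
  simp only [Pi.zero_apply, fderiv_zero, zero_apply, smul_eq_mul]
  linear_combination (invEntry (pullbackMetric G f y) i j * φ y *
    pullbackMetric G f y (shapeOp G f ν y (EuclideanSpace.single i 1))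
      (shapeOp G f ν y (EuclideanSpace.single j 1))) * hf.sign_mul_self

end IsLocalHypersurface

/-! ### Endomorphisms with two nonreal eigenvalues -/

section NilpotentEndomorphism

/-- `J` is a complex structure and `S` a nonzero `J`-linear element of square zero. -/
structure IsNilpotentPair {R : Type*} [Ring R] (J S : R) : Prop where
  J_mul_J : J * J = -1
  S_mul_J : S * J = J * S
  S_mul_S : S * S = 0
  S_ne_zero : S ≠ 0

section Ring

variable {R : Type*} [Ring R] [Algebra ℝ R] {K : R}

/-- The semisimple part of an element `K` with `(K² + 1)² = 0`; it is the Newton step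
`K - (K² + 1) / (2 K)` towards a root of `X² + 1`, because `K⁻¹ = -K` modulo `K² + 1`. -/
def semisimplePart (K : R) : R :=
  K + (1 / 2 : ℝ) • (K * (K * K + 1))

theorem isNilpotentPair_semisimplePart (hK : (K * K + 1) * (K * K + 1) = 0)
    (hK0 : K * K + 1 ≠ 0) : IsNilpotentPair (semisimplePart K) (K * K + 1) where
  J_mul_J := by
    have hsq : semisimplePart K * semisimplePart K + 1 =
        (3 / 4 : ℝ) • ((K * K + 1) * (K * K + 1))
          + (1 / 4 : ℝ) • ((K * K + 1) * ((K * K + 1) * (K * K + 1))) := by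
      simp only [semisimplePart, mul_add, add_mul, mul_assoc, smul_mul_assoc, mul_smul_comm,
        mul_one, one_mul]
      module
    rw [← add_eq_zero_iff_eq_neg, hsq, hK]
    simp
  S_mul_J := by
    simp only [semisimplePart, mul_add, add_mul, mul_assoc, smul_mul_assoc, mul_smul_comm,
      mul_one, one_mul]
    module
  S_mul_S := hK
  S_ne_zero := hK0

theorem eq_semisimplePart_sub (hK : (K * K + 1) * (K * K + 1) = 0) :
    K = semisimplePart K - (1 / 2 : ℝ) • (semisimplePart K * (K * K + 1)) := by
  rw [semisimplePart, add_mul, smul_mul_assoc, mul_assoc K, hK]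
  simp

end Ring

theorem IsNilpotentPair.anticomm_antilinear_part {R : Type*} [Ring R] [Algebra ℝ R] {J S T : R}
    (hP : IsNilpotentPair J S)
    (hT : S * ((J - (1 / 2 : ℝ) • (J * S)) * T + T * (J - (1 / 2 : ℝ) • (J * S)))
      + ((J - (1 / 2 : ℝ) • (J * S)) * T + T * (J - (1 / 2 : ℝ) • (J * S))) * S = 0) :
    S * (T - J * T * J) + (T - J * T * J) * S = 0 := by
  set D := (J - (1 / 2 : ℝ) • (J * S)) * T + T * (J - (1 / 2 : ℝ) • (J * S)) with hD
  have hJJ : ∀ a, J * (J * a) = -a := fun a => by rw [← mul_assoc, hP.J_mul_J, neg_one_mul]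
  have hSS : ∀ a, S * (S * a) = 0 := fun a => by rw [← mul_assoc, hP.S_mul_S, zero_mul]
  have hSJ : ∀ a, S * (J * a) = J * (S * a) := fun a => by
    rw [← mul_assoc, hP.S_mul_J, mul_assoc]
  have hexpand : S * (T - J * T * J) + (T - J * T * J) * S =
      -(J * ((S * D + D * S) + (1 / 4 : ℝ) • (S * (S * D + D * S) + (S * D + D * S) * S))) := by
    rw [hD]
    simp only [mul_add, add_mul, mul_sub, sub_mul, mul_assoc, hJJ, hSS, hSJ, hP.S_mul_S, zero_mul,
      smul_mul_assoc, mul_smul_comm, smul_sub, smul_add, mul_zero, smul_zero, smul_neg]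
    module
  rw [hexpand, hT]
  simp

variable {E : Type*} [NormedAddCommGroup E] [NormedSpace ℝ E]

theorem eq_zero_of_smul_add_smul_complex {J : E →L[ℝ] E} (hJ : J * J = -1) {v : E} (hv : v ≠ 0)
    {a b : ℝ} (hab : a • v + b • J v = 0) : a = 0 ∧ b = 0 := by
  have hJJ : J (J v) = -v := congrArg (· v) hJ
  have hJab : a • J v - b • v = 0 := by simpa [hJJ, sub_eq_add_neg] using congrArg J hab
  have hnorm : (a ^ 2 + b ^ 2) • v = 0 := by
    have : (a ^ 2 + b ^ 2) • v = a • (a • v + b • J v) - b • (a • J v - b • v) := by module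
    rw [this, hab, hJab, smul_zero, smul_zero, sub_zero]
  have := (smul_eq_zero.1 hnorm).resolve_right hv
  constructor <;> nlinarith [sq_nonneg a, sq_nonneg b]

namespace IsNilpotentPair

variable {J S : E →L[ℝ] E} (hP : IsNilpotentPair J S)

include hP

theorem S_apply_J (x : E) : S (J x) = J (S x) :=
  congrArg (· x) hP.S_mul_J

theorem S_apply_S (x : E) : S (S x) = 0 :=
  congrArg (· x) hP.S_mul_S

variable (hdim : Module.finrank ℝ E = 4)

include hdim

theorem exists_cyclic_vector :
    ∃ u, S u ≠ 0 ∧ ∀ x, ∃ (a b : ℝ) (w : E), x = a • u + b • J u + S w := by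
  obtain ⟨u, hu⟩ : ∃ u, S u ≠ 0 := by
    by_contra! hS
    exact hP.S_ne_zero (by ext a; simp [hS a])
  have hli : LinearIndependent ℝ ![u, J u, S u, J (S u)] := by
    rw [Fintype.linearIndependent_iff]
    intro g hg
    simp only [Fin.sum_univ_four, Matrix.cons_val_zero, Matrix.cons_val_one, Matrix.cons_val]
      at hg
    have hSg := congrArg S hg
    simp only [map_add, map_smul, hP.S_apply_J, hP.S_apply_S, map_zero, smul_zero, add_zero] at hSg
    obtain ⟨h0, h1⟩ := eq_zero_of_smul_add_smul_complex hP.J_mul_J hu hSg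
    rw [h0, h1, zero_smul, zero_smul, zero_add, zero_add] at hg
    obtain ⟨h2, h3⟩ := eq_zero_of_smul_add_smul_complex hP.J_mul_J hu hg
    intro i
    fin_cases i <;> assumption
  let B : Module.Basis (Fin 4) ℝ E :=
    .mk hli (hli.span_eq_top_of_card_eq_finrank (by simp [hdim])).ge
  refine ⟨u, hu, fun x => ⟨B.repr x 0, B.repr x 1, B.repr x 2 • u + B.repr x 3 • J u, ?_⟩⟩
  have hsum := B.sum_repr x
  rw [Module.Basis.coe_mk] at hsum
  simp only [Fin.sum_univ_four, Matrix.cons_val_zero, Matrix.cons_val_one, Matrix.cons_val] at hsum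
  rw [map_add, map_smul, map_smul, hP.S_apply_J, ← add_assoc, hsum]

theorem exists_eq_of_apply_eq_zero {x : E} (hx : S x = 0) : ∃ w, x = S w := by
  obtain ⟨u, hu, hgen⟩ := hP.exists_cyclic_vector hdim
  obtain ⟨a, b, w, rfl⟩ := hgen x
  simp only [map_add, map_smul, hP.S_apply_J, hP.S_apply_S, add_zero] at hx
  obtain ⟨rfl, rfl⟩ := eq_zero_of_smul_add_smul_complex hP.J_mul_J hu hx
  exact ⟨w, by simp⟩

variable {h : E →L[ℝ] E →L[ℝ] ℝ} (hs : ∀ u v, h u v = h v u)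
  (hn : ∀ u, (∀ v, h u v = 0) → u = 0)
  (hJsa : ∀ u v, h (J u) v = h u (J v)) (hSsa : ∀ u v, h (S u) v = h u (S v))

include hs hn hJsa hSsa

/-- `h(S t u, v)` is an alternating complex bilinear form which descends to the complex line
`E / S(E)`, and hence vanishes. -/
theorem mul_eq_zero_of_anticomm {t : E →L[ℝ] E} (htsa : ∀ u v, h (t u) v = h u (t v))
    (htJ : t * J = J * t) (htS : S * t + t * S = 0) : t * S = 0 := by
  have htJ' : ∀ a, t (J a) = J (t a) := fun a => congrArg (· a) htJ
  have htS' : ∀ a, t (S a) = -S (t a) := fun a => eq_neg_of_add_eq_zero_right (congrArg (· a) htS)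
  have halt : ∀ x y, h (S (t x)) y = -h (S (t y)) x := fun x y => by
    rw [hSsa, htsa, htS', map_neg, hs]
  obtain ⟨u, -, hgen⟩ := hP.exists_cyclic_vector hdim
  have hSt : S (t u) = 0 := by
    refine hn _ fun v => ?_
    obtain ⟨a, b, w, rfl⟩ := hgen v
    have hu : h (S (t u)) u = 0 := by linarith [halt u u]
    have hJu : h (S (t u)) (J u) = 0 := by
      have := halt u (J u)
      rw [htJ', hP.S_apply_J, hJsa] at this
      linarith
    rw [map_add, map_add, map_smul, map_smul, hu, hJu, ← hSsa, hP.S_apply_S]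
    simp
  ext x
  obtain ⟨a, b, w, rfl⟩ := hgen x
  change t (S _) = 0
  simp [htS', htJ', hP.S_apply_J, hP.S_apply_S, hSt]

end IsNilpotentPair

/-- `T` is the derivative of a self-adjoint endomorphism field satisfying the Codazzi equation:
`h (T u v) w` is totally symmetric. -/
structure IsCodazzi (h : E →L[ℝ] E →L[ℝ] ℝ) (T : E →L[ℝ] E →L[ℝ] E) : Prop where
  symm : ∀ u v, T u v = T v u
  selfAdjoint : ∀ u v w, h (T u v) w = h v (T u w)

namespace IsCodazzi

variable {h : E →L[ℝ] E →L[ℝ] ℝ} {T : E →L[ℝ] E →L[ℝ] E} (hT : IsCodazzi h T)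
  (hn : ∀ u, (∀ v, h u v = 0) → u = 0)

include hT

section NilpotentPair

variable {J S : E →L[ℝ] E} (hP : IsNilpotentPair J S)
  (hJsa : ∀ u v, h (J u) v = h u (J v)) (hSsa : ∀ u v, h (S u) v = h u (S v))

include hn hP hJsa hSsa in
theorem mul_S_eq (hdim : Module.finrank ℝ E = 4) (hs : ∀ u v, h u v = h v u) (x : E)
    (hanti : S * (T x - J * T x * J) + (T x - J * T x * J) * S = 0) :
    T x * S = J * T x * J * S := by
  refine sub_eq_zero.1 ?_
  rw [← sub_mul]
  refine hP.mul_eq_zero_of_anticomm hdim hs hn hJsa hSsa (fun u v => ?_) ?_ hanti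
  · simp only [sub_apply, ContinuousLinearMap.mul_def, ContinuousLinearMap.comp_apply, map_sub,
      hJsa, hT.selfAdjoint]
  · rw [sub_mul, mul_sub, mul_assoc (J * T x), mul_assoc J (T x) J, ← mul_assoc J J (T x * J),
      hP.J_mul_J]
    noncomm_ring

variable (hTS : ∀ x, T x * S = J * T x * J * S)

include hTS

theorem apply_S_eq_mul_left (u : E) : T (S u) = J * T (J (S u)) := by
  ext x
  have := congrArg (· u) (hTS x)
  simp only [ContinuousLinearMap.mul_def, ContinuousLinearMap.comp_apply] at this ⊢
  rw [hT.symm, this, hT.symm x]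

include hn hJsa

theorem apply_S_eq_mul_right (u : E) : T (S u) = T (J (S u)) * J := by
  ext x
  rw [← sub_eq_zero]
  refine hn _ fun w => ?_
  have := congrArg (fun a => h x (a w)) (hT.apply_S_eq_mul_left hTS u)
  simp only [ContinuousLinearMap.mul_def, ContinuousLinearMap.comp_apply] at this
  simp only [ContinuousLinearMap.mul_def, ContinuousLinearMap.comp_apply, map_sub, sub_apply,
    hT.selfAdjoint, hJsa, this, sub_self]

include hP

theorem J_mul_apply_S (u : E) : J * T (S u) = T (S u) * J := by
  have hleft : J * T (S u) = -T (J (S u)) := by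
    rw [hT.apply_S_eq_mul_left hTS u, ← mul_assoc, hP.J_mul_J, neg_one_mul]
  have hright : T (S u) * J = -T (J (S u)) := by
    rw [hT.apply_S_eq_mul_right hn hJsa hTS u, mul_assoc, hP.J_mul_J, mul_neg_one]
  rw [hleft, hright]

theorem apply_S_mul_S (u : E) : T (S u) * S = 0 := by
  have hneg := hTS (S u)
  rw [hT.J_mul_apply_S hn hP hJsa hTS, mul_assoc (T (S u)), hP.J_mul_J, mul_neg_one,
    neg_mul] at hneg
  have htwo : (2 : ℝ) • (T (S u) * S) = 0 := by
    rw [two_smul]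
    exact add_eq_zero_iff_eq_neg.2 hneg
  exact (smul_eq_zero.1 htwo).resolve_left two_ne_zero

include hSsa

theorem S_mul_apply_S (u : E) : S * T (S u) = 0 := by
  ext x
  refine hn _ fun w => ?_
  have := congrArg (fun a => h x (a w)) (hT.apply_S_mul_S hn hP hJsa hTS u)
  simp only [ContinuousLinearMap.mul_def, ContinuousLinearMap.comp_apply, zero_apply,
    map_zero] at this
  simp only [ContinuousLinearMap.mul_def, ContinuousLinearMap.comp_apply, hSsa, hT.selfAdjoint,
    this]

theorem apply_S_mul_apply_S (hdim : Module.finrank ℝ E = 4) (u v : E) :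
    T (S u) * T (S v) = 0 := by
  ext x
  obtain ⟨w, hw⟩ := hP.exists_eq_of_apply_eq_zero hdim (x := T (S v) x)
    (congrArg (· x) (hT.S_mul_apply_S hn hP hJsa hSsa hTS v))
  rw [ContinuousLinearMap.mul_def, ContinuousLinearMap.comp_apply, hw]
  exact congrArg (· w) (hT.apply_S_mul_S hn hP hJsa hTS u)

end NilpotentPair

variable {K : E →L[ℝ] E} (hK : ∀ u v, h (K u) v = h u (K v))

include hn hK

/-- The hypothesis `hE` holds when `T` is the covariant derivative of a field `K` with
`(K² + 1)² = 0`. -/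
theorem commute_of_apply_eq_zero (hdim : Module.finrank ℝ E = 4) (hs : ∀ u v, h u v = h v u)
    {S : E →L[ℝ] E} (hSK : S = K * K + 1) (hS : S * S = 0) (hS0 : S ≠ 0)
    (hE : ∀ u, S * (K * T u + T u * K) + (K * T u + T u * K) * S = 0) {x : E} (hx : S x = 0) :
    K * T x = T x * K ∧ S * T x = 0 ∧ ∀ x', S x' = 0 → T x * T x' = 0 := by
  subst hSK
  set S := K * K + 1 with hSdef
  have hP : IsNilpotentPair (semisimplePart K) S := isNilpotentPair_semisimplePart hS hS0
  set J := semisimplePart K with hJdef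
  have hKJ : K = J - (1 / 2 : ℝ) • (J * S) := eq_semisimplePart_sub hS
  have hSsa : ∀ u v, h (S u) v = h u (S v) := fun u v => by
    simp [hSdef, hK]
  have hJsa : ∀ u v, h (J u) v = h u (J v) := fun u v => by
    simp [hJdef, semisimplePart, hK]
  have hTS : ∀ x, T x * S = J * T x * J * S := fun x =>
    hT.mul_S_eq hn hP hJsa hSsa hdim hs x
      (hP.anticomm_antilinear_part (by rw [← hKJ]; exact hE x))
  obtain ⟨u, rfl⟩ := hP.exists_eq_of_apply_eq_zero hdim hx
  have hST := hT.S_mul_apply_S hn hP hJsa hSsa hTS u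
  refine ⟨?_, hST, fun x' hx' => ?_⟩
  · have hTJS : T (S u) * (J * S) = 0 := by
      rw [← hP.S_mul_J, ← mul_assoc, hT.apply_S_mul_S hn hP hJsa hTS, zero_mul]
    rw [hKJ, sub_mul, mul_sub, hT.J_mul_apply_S hn hP hJsa hTS, smul_mul_assoc, mul_smul_comm,
      mul_assoc, hST, hTJS, mul_zero]
  · obtain ⟨v, rfl⟩ := hP.exists_eq_of_apply_eq_zero hdim hx'
    exact hT.apply_S_mul_apply_S hn hP hJsa hSsa hTS hdim u v

theorem eq_zero_of_anticomm (hKK : K * K = -1) (hE : ∀ u, K * T u + T u * K = 0) : T = 0 := by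
  have hright : ∀ u v, T u (K v) = -K (T u v) := fun u v =>
    eq_neg_of_add_eq_zero_right (congrArg (· v) (hE u))
  have hleft : ∀ u v, T (K u) v = -K (T u v) := fun u v => by rw [hT.symm, hright, hT.symm]
  have hKT : ∀ u v, K (T u v) = 0 := by
    refine fun u v => hn _ fun w => ?_
    have hKTw : h (T (K u) v) w = h (K (T u v)) w := by
      rw [hT.selfAdjoint, hleft, map_neg, ← hK, ← hT.selfAdjoint, hright, map_neg, neg_apply,
        neg_neg]
    rw [hleft, map_neg, neg_apply] at hKTw
    linarith
  ext u v
  have hKK' : K (K (T u v)) = -T u v := congrArg (· (T u v)) hKK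
  rw [hKT, map_zero] at hKK'
  exact neg_eq_zero.1 hKK'.symm

end IsCodazzi

theorem eq_zero_of_double_commutator {h : E →L[ℝ] E →L[ℝ] ℝ}
    (hn : ∀ u, (∀ v, h u v = 0) → u = 0) {K : E →L[ℝ] E} (hK : ∀ u v, h (K u) v = h u (K v))
    {n : E} (hn0 : n ≠ 0) (hKK : K (K n) = -n) {κ : ℝ} {R : E → E}
    (hR : ∀ w, R w = κ • (h (K n) w • n - h n w • K n))
    (hcomm : ∀ w, R (K (K w)) - K (R (K w)) = K (R (K w) - K (R w))) : κ = 0 := by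
  by_contra hκ
  refine hn0 (hn n fun w => ?_)
  have hwedge : h (K n) w • n - h n w • K n = 0 := by
    have hfour : (4 * κ) • (h (K n) w • n - h n w • K n) = 0 := by
      have hcomm := sub_eq_zero.2 (hcomm w)
      simp only [hR, map_smul, map_sub, hKK, ← hK, map_neg, neg_apply] at hcomm
      rw [← neg_eq_zero, ← hcomm]
      module
    exact (smul_eq_zero.1 hfour).resolve_left (by simpa using hκ)
  have hKwedge := congrArg K hwedge
  simp only [map_sub, map_smul, hKK, map_zero] at hKwedge
  by_contra hw
  have hnorm : (h (K n) w ^ 2 + h n w ^ 2) • n = 0 := by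
    have : (h (K n) w ^ 2 + h n w ^ 2) • n = h (K n) w • (h (K n) w • n - h n w • K n)
        + h n w • (h (K n) w • K n - h n w • -n) := by module
    rw [this, hwedge, hKwedge, smul_zero, smul_zero, add_zero]
  exact (smul_ne_zero (by positivity) hn0) hnorm

end NilpotentEndomorphism

/-! ### Conjugate pairs of eigenvalues -/

section ConjPoly

open Polynomial

/-- The monic real quadratic polynomial with roots `α ± i β`. -/
def conjPoly (α β : ℝ) : ℝ[X] := X ^ 2 - C (2 * α) * X + C (α ^ 2 + β ^ 2)

variable {α β : ℝ}

theorem natDegree_conjPoly : (conjPoly α β).natDegree = 2 := by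
  rw [conjPoly]
  compute_degree!

theorem monic_conjPoly : (conjPoly α β).Monic := by
  rw [conjPoly]
  monicity!

theorem nextCoeff_conjPoly : (conjPoly α β).nextCoeff = -(2 * α) := by
  rw [nextCoeff_of_natDegree_pos (by simp [natDegree_conjPoly]), natDegree_conjPoly, conjPoly]
  simp only [coeff_add, coeff_sub, coeff_X_pow, coeff_C_mul, coeff_C, coeff_X]
  norm_num

theorem aeval_conjPoly {R : Type*} [Ring R] [Algebra ℝ R] (A : R) :
    aeval A (conjPoly α β) = A * A - (2 * α) • A + (α ^ 2 + β ^ 2) • 1 := by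
  simp [conjPoly, Algebra.smul_def, sq]

theorem mul_self_add_one_eq_smul_aeval_conjPoly {R : Type*} [Ring R] [Algebra ℝ R] (A : R)
    (hβ : β ≠ 0) :
    β⁻¹ • (A - α • 1) * β⁻¹ • (A - α • 1) + 1 = β⁻¹ ^ 2 • aeval A (conjPoly α β) := by
  rw [aeval_conjPoly, smul_mul_smul_comm]
  simp only [sub_mul, mul_sub, smul_mul_assoc, mul_smul_comm, one_mul, mul_one]
  match_scalars <;> field_simp
  ring

theorem conjPoly_dvd_of_aeval_eq_zero {P : ℝ[X]} {z : ℂ} (hz : aeval z P = 0) (him : z.im ≠ 0) :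
    conjPoly z.re |z.im| ∣ P := by
  have hnorm : ‖z‖ ^ 2 = z.re ^ 2 + |z.im| ^ 2 := by
    rw [← Complex.normSq_eq_norm_sq, Complex.normSq_apply, sq_abs, sq, sq]
  rw [conjPoly, ← hnorm]
  exact P.quadratic_dvd_of_aeval_eq_zero_im_ne_zero hz him

theorem exists_eq_conjPoly_sq {P : ℝ[X]} (hP : P.Monic) (hdeg : P.natDegree = 4)
    (hcard : {μ : ℂ | (P.map (algebraMap ℝ ℂ)).IsRoot μ}.ncard = 2)
    (him : ∀ μ ∈ {μ : ℂ | (P.map (algebraMap ℝ ℂ)).IsRoot μ}, μ.im ≠ 0) :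
    ∃ α β : ℝ, 0 < β ∧ P = conjPoly α β ^ 2 := by
  set S := {μ : ℂ | (P.map (algebraMap ℝ ℂ)).IsRoot μ} with hS
  have hroot : ∀ μ, μ ∈ S ↔ aeval μ P = 0 := fun μ => by
    rw [hS, Set.mem_ofPred_eq, IsRoot.def, eval_map_algebraMap]
  obtain ⟨z, hz⟩ : S.Nonempty := Set.nonempty_of_ncard_ne_zero (by lia)
  have hconj : (starRingEnd ℂ) z ∈ S := by
    rw [hroot, aeval_conj, (hroot z).1 hz, map_zero]
  have hne : z ≠ (starRingEnd ℂ) z := fun h => him z hz (Complex.conj_eq_iff_im.1 h.symm)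
  have hSeq : {z, (starRingEnd ℂ) z} = S :=
    Set.eq_of_subset_of_ncard_le (Set.insert_subset hz (Set.singleton_subset_iff.2 hconj))
      (by rw [hcard, Set.ncard_pair hne]) (Set.finite_of_ncard_ne_zero (by lia))
  have hdvd : ∀ w ∈ S, ∀ Q : ℝ[X], aeval w Q = 0 → conjPoly z.re |z.im| ∣ Q := by
    intro w hw Q hQ
    have hwQ := conjPoly_dvd_of_aeval_eq_zero hQ (him w hw)
    rw [← hSeq] at hw
    rcases hw with rfl | rfl
    · exact hwQ
    · simpa using hwQ
  refine ⟨z.re, |z.im|, abs_pos.2 (him z hz), ?_⟩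
  obtain ⟨R, hR⟩ := hdvd z hz P ((hroot z).1 hz)
  have hRm : R.Monic := monic_conjPoly.of_mul_monic_left (hR ▸ hP)
  have hRdeg : R.natDegree = 2 := by
    have hmul := (monic_conjPoly (α := z.re) (β := |z.im|)).natDegree_mul hRm
    rw [← hR, hdeg, natDegree_conjPoly] at hmul
    lia
  obtain ⟨w, hw⟩ := Complex.exists_root (f := R.map (algebraMap ℝ ℂ))
    (by rw [degree_map, degree_eq_natDegree hRm.ne_zero, hRdeg]; norm_num)
  rw [IsRoot.def, eval_map_algebraMap] at hw
  have hwS : w ∈ S := by rw [hroot, hR, map_mul, hw, mul_zero]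
  rw [hR, eq_of_monic_of_dvd_of_natDegree_le monic_conjPoly hRm (hdvd w hwS R hw)
    (hRdeg.trans natDegree_conjPoly.symm).le, sq]

variable {V : Type*} [AddCommGroup V] [Module ℝ V] [FiniteDimensional ℝ V] {A : Module.End ℝ V}

theorem trace_of_charpoly_eq_conjPoly_sq [Nontrivial V] (hA : A.charpoly = conjPoly α β ^ 2) :
    LinearMap.trace ℝ V A = 4 * α := by
  rw [LinearMap.trace_eq_matrix_trace ℝ (Module.finBasis ℝ V),
    Matrix.trace_eq_neg_charpoly_nextCoeff, LinearMap.charpoly_toMatrix, hA, sq,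
    monic_conjPoly.nextCoeff_mul monic_conjPoly, nextCoeff_conjPoly]
  ring

theorem aeval_conjPoly_sq_eq_zero (hA : A.charpoly = conjPoly α β ^ 2) :
    aeval A (conjPoly α β) ^ 2 = 0 := by
  rw [← map_pow, ← hA, A.aeval_self_charpoly]

/-- The trace of the nilpotent endomorphism `(A - α)² + β²` vanishes. -/
theorem trace_sq_of_charpoly_eq_conjPoly_sq (hdim : Module.finrank ℝ V = 4)
    (hA : A.charpoly = conjPoly α β ^ 2) :
    LinearMap.trace ℝ V (A * A) = 4 * (α ^ 2 - β ^ 2) := by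
  have : Nontrivial V := Module.nontrivial_of_finrank_pos (R := ℝ) (by lia)
  have htr := (LinearMap.isNilpotent_trace_of_isNilpotent
    (f := aeval A (conjPoly α β)) ⟨2, aeval_conjPoly_sq_eq_zero hA⟩).eq_zero
  rw [aeval_conjPoly, map_add, map_sub, map_smul, map_smul, trace_of_charpoly_eq_conjPoly_sq hA,
    LinearMap.trace_one, hdim, smul_eq_mul, smul_eq_mul] at htr
  push_cast at htr
  linarith

theorem eq_zero_of_apply_eq_smul
    (him : ∀ μ ∈ {μ : ℂ | (A.charpoly.map (algebraMap ℝ ℂ)).IsRoot μ}, μ.im ≠ 0)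
    {r : ℝ} {v : V} (hv : A v = r • v) : v = 0 := by
  by_contra hne
  have hroot := (Module.End.hasEigenvalue_iff_isRoot_charpoly A r).1
    (Module.End.hasEigenvalue_of_hasEigenvector (Module.End.hasEigenvector_iff.2
      ⟨Module.End.mem_eigenspace_iff.2 hv, hne⟩))
  exact him (r : ℂ) (hroot.map (f := algebraMap ℝ ℂ)) (Complex.ofReal_im r)

theorem aeval_conjPoly_sq_eq_zero_of_conj {E : Type*} [NormedAddCommGroup E] [NormedSpace ℝ E]
    {B : E →L[ℝ] E} (e : E ≃ₗ[ℝ] E) (h : aeval (e.conj B.toLinearMap) (conjPoly α β) ^ 2 = 0) :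
    aeval B (conjPoly α β) ^ 2 = 0 := by
  have hB : aeval B.toLinearMap (conjPoly α β) ^ 2 = 0 := by
    refine (map_eq_zero_iff (e.conjAlgEquiv ℝ) (e.conjAlgEquiv ℝ).injective).1 ?_
    rw [map_pow, ← aeval_algHom_apply]
    exact h
  ext v
  have hv := LinearMap.congr_fun hB v
  rw [aeval_conjPoly] at hv ⊢
  exact hv

end ConjPoly

/-! ### Fields of endomorphisms -/

section EndomorphismField

variable {E : Type*} [NormedAddCommGroup E] [NormedSpace ℝ E]

section CovDerivEnd

variable {Γ : E → E →L[ℝ] E →L[ℝ] E} {B C : E → E →L[ℝ] E} {y : E}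

theorem covDerivEnd_congr (h : B =ᶠ[nhds y] C) : covDerivEnd Γ B y = covDerivEnd Γ C y := by
  rw [covDerivEnd, covDerivEnd, h.fderiv_eq, h.eq_of_nhds]

theorem covDerivEnd_zero : covDerivEnd Γ (fun _ => 0) y = 0 := by
  ext u
  simp [covDerivEnd_apply]

theorem covDerivEnd_eq_zero_of_eventually (h : ∀ᶠ z in nhds y, B z = 0) :
    covDerivEnd Γ B y = 0 :=
  (covDerivEnd_congr h).trans covDerivEnd_zero

theorem covDerivEnd_one : covDerivEnd Γ (fun _ => 1) y = 0 := by
  ext u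
  simp [covDerivEnd_apply]

theorem covDerivEnd_add (hB : DifferentiableAt ℝ B y) (hC : DifferentiableAt ℝ C y) :
    covDerivEnd Γ (fun z => B z + C z) y = covDerivEnd Γ B y + covDerivEnd Γ C y := by
  ext1 u
  simp only [covDerivEnd_apply, fderiv_fun_add hB hC, add_apply]
  noncomm_ring

theorem covDerivEnd_sub (hB : DifferentiableAt ℝ B y) (hC : DifferentiableAt ℝ C y) :
    covDerivEnd Γ (fun z => B z - C z) y = covDerivEnd Γ B y - covDerivEnd Γ C y := by
  ext1 u
  simp only [covDerivEnd_apply, fderiv_fun_sub hB hC, sub_apply]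
  noncomm_ring

theorem covDerivEnd_const_smul (a : ℝ) (hB : DifferentiableAt ℝ B y) :
    covDerivEnd Γ (fun z => a • B z) y = a • covDerivEnd Γ B y := by
  ext1 u
  simp only [covDerivEnd_apply, fderiv_fun_const_smul hB, smul_apply, mul_smul_comm,
    smul_mul_assoc]
  module

theorem fderiv_mul_end (hB : DifferentiableAt ℝ B y) (hC : DifferentiableAt ℝ C y) (u : E) :
    fderiv ℝ (fun z => B z * C z) y u = fderiv ℝ B y u * C y + B y * fderiv ℝ C y u := by
  rw [fderiv_fun_mul' hB hC, add_comm]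
  rfl

theorem covDerivEnd_mul (hB : DifferentiableAt ℝ B y) (hC : DifferentiableAt ℝ C y) (u : E) :
    covDerivEnd Γ (fun z => B z * C z) y u =
      covDerivEnd Γ B y u * C y + B y * covDerivEnd Γ C y u := by
  simp only [covDerivEnd_apply, fderiv_mul_end hB hC]
  noncomm_ring

theorem differentiableAt_mul_self_add_one (hB : DifferentiableAt ℝ B y) :
    DifferentiableAt ℝ (fun z => B z * B z + 1) y :=
  (hB.clm_comp hB).add (differentiableAt_const 1)

theorem covDerivEnd_mul_self_add_one (hB : DifferentiableAt ℝ B y) (u : E) :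
    covDerivEnd Γ (fun z => B z * B z + 1) y u =
      B y * covDerivEnd Γ B y u + covDerivEnd Γ B y u * B y := by
  rw [covDerivEnd_add (B := fun z => B z * B z) (C := fun _ => 1) (hB.clm_comp hB)
    (differentiableAt_const 1), covDerivEnd_one, add_zero, covDerivEnd_mul hB hB, add_comm]

theorem contDiffAt_covDerivEnd (hΓ : ContDiffAt ℝ ∞ Γ y) (hB : ContDiffAt ℝ ∞ B y) :
    ContDiffAt ℝ ∞ (covDerivEnd Γ B) y := by
  have hpostcomp := (ContinuousLinearMap.compL ℝ E E E).contDiff.contDiffAt.comp y hB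
  have hprecomp := (ContinuousLinearMap.compL ℝ E E E).flip.contDiff.contDiffAt.comp y hB
  exact ((contDiffAt_fderiv hB).add (hpostcomp.clm_comp hΓ.neg)).add (hprecomp.clm_comp hΓ)

/-- The second covariant derivative `∇²_{u, v} A` of a field of endomorphisms `A`. -/
def secondCovDerivEnd (Γ : E → E →L[ℝ] E →L[ℝ] E) (A : E → E →L[ℝ] E) (y u v : E) : E →L[ℝ] E :=
  covDerivEnd Γ (fun z => covDerivEnd Γ A z v) y u - covDerivEnd Γ A y (Γ y u v)

theorem covDerivEnd_covDerivEnd_apply {X : E → E} (hB : DifferentiableAt ℝ (covDerivEnd Γ B) y)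
    (hX : DifferentiableAt ℝ X y) (u : E) :
    covDerivEnd Γ (fun z => covDerivEnd Γ B z (X z)) y u =
      secondCovDerivEnd Γ B y u (X y) + covDerivEnd Γ B y (fderiv ℝ X y u + Γ y u (X y)) := by
  have hleibniz : fderiv ℝ (fun z => covDerivEnd Γ B z (X z)) y u =
      fderiv ℝ (covDerivEnd Γ B) y u (X y) + covDerivEnd Γ B y (fderiv ℝ X y u) := by
    rw [fderiv_clm_apply hB hX, add_apply, ContinuousLinearMap.comp_apply, add_comm]
    rfl
  rw [secondCovDerivEnd, covDerivEnd_apply, hleibniz,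
    covDerivEnd_apply Γ (fun z => covDerivEnd Γ B z (X y)), fderiv_clm_apply_const hB, map_add]
  abel

theorem ricci_identity [FiniteDimensional ℝ E] {h : E → E →L[ℝ] E →L[ℝ] ℝ} {U : Set E}
    (hh : IsLocalMetric h U) (hy : y ∈ U) (hB : ContDiffAt ℝ ∞ B y) (u v w : E) :
    (secondCovDerivEnd (christoffel h) B y u v - secondCovDerivEnd (christoffel h) B y v u) w =
      curvature h y u v (B y w) - B y (curvature h y u v w) := by
  have hΓ := hh.differentiableAt_christoffel hy
  have hB' := hB.differentiableAt (by simp)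
  have hdB : DifferentiableAt ℝ (fderiv ℝ B) y := (contDiffAt_fderiv hB).differentiableAt (by simp)
  have hΓv : ∀ v, DifferentiableAt ℝ (fun z => christoffel h z v) y := fun v => by fun_prop
  have hderiv : ∀ a b, fderiv ℝ (fun z => covDerivEnd (christoffel h) B z b) y a =
      fderiv ℝ (fderiv ℝ B) y a b
        + (fderiv ℝ (christoffel h) y a b * B y + christoffel h y b * fderiv ℝ B y a)
        - (fderiv ℝ B y a * christoffel h y b + B y * fderiv ℝ (christoffel h) y a b) := by
    intro a b
    have hΓB : DifferentiableAt ℝ (fun z => christoffel h z b * B z) y := (hΓv b).clm_comp hB'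
    have hBΓ : DifferentiableAt ℝ (fun z => B z * christoffel h z b) y := hB'.clm_comp (hΓv b)
    simp only [covDerivEnd_apply]
    rw [fderiv_fun_sub (DifferentiableAt.fun_add (by fun_prop) hΓB) hBΓ,
      fderiv_fun_add (by fun_prop) hΓB, sub_apply, add_apply, fderiv_mul_end (hΓv b) hB',
      fderiv_mul_end hB' (hΓv b), fderiv_clm_apply_const hdB, fderiv_clm_apply_const hΓ]
  rw [secondCovDerivEnd, secondCovDerivEnd, hh.christoffel_symm hy v u, sub_sub_sub_cancel_right,
    covDerivEnd_apply, hderiv, covDerivEnd_apply _ (fun z => covDerivEnd (christoffel h) B z u),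
    hderiv, fderiv_fderiv_comm hB v u, hh.curvature_eq hy, hh.curvature_eq hy]
  simp only [covDerivEnd_apply, ContinuousLinearMap.mul_def, ContinuousLinearMap.comp_apply,
    sub_apply, add_apply, map_sub, map_add]
  abel

end CovDerivEnd

/-- `K` is a smooth self-adjoint field of endomorphisms of `(U, h)` satisfying the Codazzi equation
`(∇_u K) v = (∇_v K) u`. -/
structure IsCodazziField (h : E → E →L[ℝ] E →L[ℝ] ℝ) (U : Set E) (K : E → E →L[ℝ] E) :
    Prop where
  contDiffAt : ∀ y ∈ U, ContDiffAt ℝ ∞ K y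
  selfAdjoint : ∀ y ∈ U, ∀ u v, h y (K y u) v = h y u (K y v)
  codazzi : ∀ y ∈ U, ∀ u v,
    covDerivEnd (christoffel h) K y u v = covDerivEnd (christoffel h) K y v u

namespace IsCodazziField

variable {h : E → E →L[ℝ] E →L[ℝ] ℝ} {U : Set E} {K : E → E →L[ℝ] E}
  (hKU : IsCodazziField h U K)

include hKU

theorem differentiableAt {y : E} (hy : y ∈ U) : DifferentiableAt ℝ K y :=
  (hKU.contDiffAt y hy).differentiableAt (by simp)

theorem smul_sub_smul_one (a b : ℝ) : IsCodazziField h U fun y => a • (K y - b • 1) where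
  contDiffAt y hy := ((hKU.contDiffAt y hy).sub contDiffAt_const).const_smul _
  selfAdjoint y hy u v := by
    simp [hKU.selfAdjoint y hy]
  codazzi y hy u v := by
    have hK := hKU.differentiableAt hy
    have hone : DifferentiableAt ℝ (fun _ => b • (1 : E →L[ℝ] E)) y := by fun_prop
    rw [covDerivEnd_const_smul _ (hK.fun_sub hone), covDerivEnd_sub hK hone,
      covDerivEnd_const_smul _ (differentiableAt_const _), covDerivEnd_one, smul_zero, sub_zero,
      smul_apply, smul_apply, smul_apply, smul_apply, hKU.codazzi y hy]

variable [FiniteDimensional ℝ E] (hh : IsLocalMetric h U)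

include hh

theorem isCodazzi {y : E} (hy : y ∈ U) : IsCodazzi (h y) (covDerivEnd (christoffel h) K y) where
  symm := hKU.codazzi y hy
  selfAdjoint := hh.inner_covDerivEnd_comm hKU.selfAdjoint hy (hKU.differentiableAt hy)

theorem differentiableAt_covDerivEnd {y : E} (hy : y ∈ U) :
    DifferentiableAt ℝ (covDerivEnd (christoffel h) K) y :=
  (contDiffAt_covDerivEnd (hh.contDiffAt_christoffel hy) (hKU.contDiffAt y hy)).differentiableAt
    (by simp)

theorem covDerivEnd_eq_zero (hKK : ∀ y ∈ U, K y * K y = -1) {y : E} (hy : y ∈ U) :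
    covDerivEnd (christoffel h) K y = 0 := by
  refine (hKU.isCodazzi hh hy).eq_zero_of_anticomm (hh.nondegenerate y hy) (hKU.selfAdjoint y hy)
    (hKK y hy) fun u => ?_
  rw [← covDerivEnd_mul_self_add_one (hKU.differentiableAt hy), covDerivEnd_eq_zero_of_eventually,
    zero_apply]
  filter_upwards [hh.mem_nhds hy] with z hz
  rw [hKK z hz, neg_add_cancel]

theorem curvature_apply_comm (hKK : ∀ y ∈ U, K y * K y = -1) {y : E} (hy : y ∈ U) (u v w : E) :
    curvature h y u v (K y w) = K y (curvature h y u v w) := by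
  have hsecond : ∀ u v, secondCovDerivEnd (christoffel h) K y u v = 0 := by
    intro u v
    have hzero : ∀ᶠ z in nhds y, covDerivEnd (christoffel h) K z v = 0 := by
      filter_upwards [hh.mem_nhds hy] with z hz
      rw [hKU.covDerivEnd_eq_zero hh hKK hz, zero_apply]
    rw [secondCovDerivEnd, covDerivEnd_eq_zero_of_eventually hzero,
      hKU.covDerivEnd_eq_zero hh hKK hy, zero_apply, zero_apply, sub_zero]
  rw [← sub_eq_zero, ← ricci_identity hh hy (hKU.contDiffAt y hy), hsecond, hsecond,
    sub_zero, zero_apply]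

variable (hdim : Module.finrank ℝ E = 4)
  (hK : ∀ y ∈ U, (K y * K y + 1) * (K y * K y + 1) = 0) {y : E} (hy : y ∈ U)
  (hSy : K y * K y + 1 ≠ 0)

include hdim hK hy hSy

theorem covDerivEnd_commute {x : E} (hx : (K y * K y + 1) x = 0) :
    K y * covDerivEnd (christoffel h) K y x = covDerivEnd (christoffel h) K y x * K y ∧
      (K y * K y + 1) * covDerivEnd (christoffel h) K y x = 0 ∧
      ∀ x', (K y * K y + 1) x' = 0 →
        covDerivEnd (christoffel h) K y x * covDerivEnd (christoffel h) K y x' = 0 := by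
  refine (hKU.isCodazzi hh hy).commute_of_apply_eq_zero (hh.nondegenerate y hy)
    (hKU.selfAdjoint y hy) hdim (hh.symm y hy) rfl (hK y hy) hSy (fun u => ?_) hx
  have hd := hKU.differentiableAt hy
  have hSd := differentiableAt_mul_self_add_one hd
  rw [← covDerivEnd_mul_self_add_one hd, add_comm, ← covDerivEnd_mul hSd hSd,
    covDerivEnd_eq_zero_of_eventually, zero_apply]
  filter_upwards [hh.mem_nhds hy] with z hz using hK z hz

/-- Differentiate `[K, ∇_X K] = 0` for the section `X = (K² + 1) a` of the kernel of `K² + 1`. -/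
theorem commute_covDerivEnd_section (a : E) {n : E} (hn : (K y * K y + 1) n = 0) :
    K y * covDerivEnd (christoffel h)
        (fun z => covDerivEnd (christoffel h) K z ((K z * K z + 1) a)) y n =
      covDerivEnd (christoffel h)
        (fun z => covDerivEnd (christoffel h) K z ((K z * K z + 1) a)) y n * K y := by
  let B : E → E →L[ℝ] E := fun z => covDerivEnd (christoffel h) K z ((K z * K z + 1) a)
  have hKd := hKU.differentiableAt hy
  have hSd := differentiableAt_mul_self_add_one hKd
  have hBd : DifferentiableAt ℝ B y :=
    (hKU.differentiableAt_covDerivEnd hh hy).clm_apply (hSd.clm_apply (differentiableAt_const a))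
  have hker : ∀ z ∈ U, (K z * K z + 1) ((K z * K z + 1) a) = 0 := fun z hz =>
    congrArg (· a) (hK z hz)
  have hKB : ∀ᶠ z in nhds y, K z * B z - B z * K z = 0 := by
    filter_upwards [hh.mem_nhds hy, hSd.continuousAt.eventually_ne hSy] with z hz hSz
    exact sub_eq_zero.2 (hKU.covDerivEnd_commute hh hdim hK hz hSz (hker z hz)).1
  have hzero := congrArg (· n) (covDerivEnd_eq_zero_of_eventually (Γ := christoffel h) hKB)
  have hTB : covDerivEnd (christoffel h) K y n * B y = 0 :=
    (hKU.covDerivEnd_commute hh hdim hK hy hSy hn).2.2 _ (hker y hy)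
  have hBT : B y * covDerivEnd (christoffel h) K y n = 0 :=
    (hKU.covDerivEnd_commute hh hdim hK hy hSy (hker y hy)).2.2 n hn
  simpa only [covDerivEnd_sub (B := fun z => K z * B z) (C := fun z => B z * K z)
    (hKd.clm_comp hBd) (hBd.clm_comp hKd), sub_apply, covDerivEnd_mul hKd hBd,
    covDerivEnd_mul hBd hKd, hTB, hBT, zero_add, add_zero, zero_apply, sub_eq_zero] using hzero

theorem mul_self_add_one_apply_covDerivEnd (a : E) {n : E} (hn : (K y * K y + 1) n = 0) :
    (K y * K y + 1) (covDerivEnd (christoffel h) (fun z => K z * K z + 1) y n a) = 0 := by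
  obtain ⟨hKT, hST, -⟩ := hKU.covDerivEnd_commute hh hdim hK hy hSy hn
  suffices (K y * K y + 1) * covDerivEnd (christoffel h) (fun z => K z * K z + 1) y n = 0 from
    congrArg (· a) this
  rw [covDerivEnd_mul_self_add_one (hKU.differentiableAt hy), hKT, mul_add, ← mul_assoc, hST,
    zero_mul, zero_add]

theorem secondCovDerivEnd_commute (a : E) {n : E} (hn : (K y * K y + 1) n = 0) :
    K y * secondCovDerivEnd (christoffel h) K y n ((K y * K y + 1) a) =
      secondCovDerivEnd (christoffel h) K y n ((K y * K y + 1) a) * K y := by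
  have hSd := differentiableAt_mul_self_add_one (hKU.differentiableAt hy)
  have hSad : DifferentiableAt ℝ (fun z => (K z * K z + 1) a) y :=
    hSd.clm_apply (differentiableAt_const a)
  have hX : (K y * K y + 1) (fderiv ℝ (fun z => (K z * K z + 1) a) y n
      + christoffel h y n ((K y * K y + 1) a)) = 0 := by
    have hcov : fderiv ℝ (fun z => (K z * K z + 1) a) y n
        + christoffel h y n ((K y * K y + 1) a) =
        covDerivEnd (christoffel h) (fun z => K z * K z + 1) y n a
          + (K y * K y + 1) (christoffel h y n a) := by
      rw [fderiv_clm_apply_const hSd, covDerivEnd_apply]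
      simp only [sub_apply, add_apply, ContinuousLinearMap.mul_def, ContinuousLinearMap.comp_apply]
      abel
    rw [hcov, map_add, hKU.mul_self_add_one_apply_covDerivEnd hh hdim hK hy hSy a hn, zero_add]
    exact congrArg (· (christoffel h y n a)) (hK y hy)
  have hsecond := eq_sub_of_add_eq (covDerivEnd_covDerivEnd_apply
    (hKU.differentiableAt_covDerivEnd hh hy) hSad n).symm
  rw [hsecond, mul_sub, sub_mul, hKU.commute_covDerivEnd_section hh hdim hK hy hSy a hn,
    (hKU.covDerivEnd_commute hh hdim hK hy hSy hX).1]

theorem curvature_double_commutator (b w : E) :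
    let n := (K y * K y + 1) b
    curvature h y n (K y n) (K y (K y w)) - K y (curvature h y n (K y n) (K y w)) =
      K y (curvature h y n (K y n) (K y w) - K y (curvature h y n (K y n) w)) := by
  intro n
  have hSn : (K y * K y + 1) n = 0 := congrArg (· b) (hK y hy)
  have hSK : ∀ a, (K y * K y + 1) (K y a) = K y ((K y * K y + 1) a) := fun a => by
    simp [map_add]
  have hSKn : (K y * K y + 1) (K y n) = 0 := by rw [hSK, hSn, map_zero]
  have hleft := hKU.secondCovDerivEnd_commute hh hdim hK hy hSy (K y b) hSn
  have hright := hKU.secondCovDerivEnd_commute hh hdim hK hy hSy b hSKn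
  rw [hSK] at hleft
  have hcomm := congrArg (· w) (congrArg₂ (· - ·) hleft hright)
  simp only [← mul_sub, ← sub_mul] at hcomm
  simp only [← ricci_identity hh hy (hKU.contDiffAt y hy)]
  exact hcomm.symm

omit hy hSy

theorem exists_curvature_double_commutator (hU : U.Nonempty) :
    ∃ y ∈ U, ∃ n, n ≠ 0 ∧ K y (K y n) = -n ∧ ∀ w,
      curvature h y n (K y n) (K y (K y w)) - K y (curvature h y n (K y n) (K y w)) =
        K y (curvature h y n (K y n) (K y w) - K y (curvature h y n (K y n) w)) := by
  by_cases! hKK : ∀ y ∈ U, K y * K y = -1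
  · obtain ⟨y, hy⟩ := hU
    have : Nontrivial E := Module.nontrivial_of_finrank_pos (R := ℝ) (by lia)
    obtain ⟨n, hn⟩ := exists_ne (0 : E)
    refine ⟨y, hy, n, hn, congrArg (· n) (hKK y hy), fun w => ?_⟩
    simp only [hKU.curvature_apply_comm hh hKK hy, sub_self, map_zero]
  · obtain ⟨y, hy, hKy⟩ := hKK
    have hSy : K y * K y + 1 ≠ 0 := fun hS => hKy (eq_neg_of_add_eq_zero_left hS)
    obtain ⟨b, hb⟩ : ∃ b, (K y * K y + 1) b ≠ 0 := by
      by_contra! hzero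
      exact hSy (ContinuousLinearMap.ext hzero)
    exact ⟨y, hy, _, hb, eq_neg_of_add_eq_zero_left (congrArg (· b) (hK y hy)),
      hKU.curvature_double_commutator hh hdim hK hy hSy b⟩

end IsCodazziField

section Trace

variable [FiniteDimensional ℝ E] {A : E → E →L[ℝ] E} {y : E}

theorem fderiv_trace (hA : DifferentiableAt ℝ A y) (w : E) :
    fderiv ℝ (fun z => LinearMap.trace ℝ E (A z).toLinearMap) y w =
      LinearMap.trace ℝ E (fderiv ℝ A y w).toLinearMap := by
  let L : (E →L[ℝ] E) →L[ℝ] ℝ :=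
    LinearMap.toContinuousLinearMap (LinearMap.trace ℝ E ∘ₗ ContinuousLinearMap.coeLM ℝ)
  exact congrArg (· w) (L.hasFDerivAt.comp y hA.hasFDerivAt).fderiv

theorem contDiffAt_trace (hA : ContDiffAt ℝ ∞ A y) :
    ContDiffAt ℝ ∞ (fun z => LinearMap.trace ℝ E (A z).toLinearMap) y := by
  let L : (E →L[ℝ] E) →L[ℝ] ℝ :=
    LinearMap.toContinuousLinearMap (LinearMap.trace ℝ E ∘ₗ ContinuousLinearMap.coeLM ℝ)
  exact L.contDiff.contDiffAt.comp y hA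

end Trace

namespace IsLocalHypersurface

section Cartan

variable {F : Type*} [NormedAddCommGroup F] [NormedSpace ℝ F] [FiniteDimensional ℝ E]
  [FiniteDimensional ℝ F] {G : F → F →L[ℝ] F →L[ℝ] ℝ} {V : Set F} {f ν : E → F} {U : Set E}
  {ε c : ℝ} (hf : IsLocalHypersurface G V f ν U ε) (hc : HasConstantCurvature G V c)

include hf hc

theorem isCodazziField_shapeOp : IsCodazziField (pullbackMetric G f) U (shapeOp G f ν) where
  contDiffAt _ hy := hf.contDiffAt_shapeOp hy
  selfAdjoint _ hy := hf.inner_shapeOp_comm hy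
  codazzi _ hy := hf.codazzi_equation hy hc

/-- By the Gauss equation, `R(n, K n)` is `c + ε (α² + β²)` times `n ∧ K n`, because
`A n ∧ A K n = (α² + β²) n ∧ K n`. -/
theorem cartan_identity (hU : U.Nonempty) (hdim : Module.finrank ℝ E = 4) {α β : ℝ} (hβ : β ≠ 0)
    (hA : ∀ y ∈ U, Polynomial.aeval (shapeOp G f ν y) (conjPoly α β) ^ 2 = 0) :
    c + ε * (α ^ 2 + β ^ 2) = 0 := by
  have hh := hf.isLocalMetric_pullbackMetric
  set A := shapeOp G f ν
  set h := pullbackMetric G f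
  let K : E → E →L[ℝ] E := fun y => β⁻¹ • (A y - α • 1)
  have hK : IsCodazziField h U K := (hf.isCodazziField_shapeOp hc).smul_sub_smul_one β⁻¹ α
  have hsq : ∀ y ∈ U, (K y * K y + 1) * (K y * K y + 1) = 0 := fun y hy => by
    rw [mul_self_add_one_eq_smul_aeval_conjPoly (A y) hβ, smul_mul_smul_comm,
      ← sq (Polynomial.aeval (A y) _), hA y hy, smul_zero]
  obtain ⟨y, hy, n, hn, hKn, hcomm⟩ := hK.exists_curvature_double_commutator hh hdim hsq hU
  refine eq_zero_of_double_commutator (hh.nondegenerate y hy) (hK.selfAdjoint y hy) hn hKn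
    (R := curvature h y n (K y n)) (fun w => ?_) hcomm
  have hAK : ∀ u, A y u = α • u + β • K y u := by
    intro u
    simp only [K, smul_apply, sub_apply, smul_smul, mul_inv_cancel₀ hβ,
      one_apply_eq_self]
    module
  rw [hf.gauss_equation hy hc, hAK, hAK, hKn]
  simp only [h, map_add, map_smul, map_neg, add_apply, smul_apply, neg_apply, smul_eq_mul]
  module

end Cartan

section MeanCurvature

variable {n m : ℕ} {G : Coord n → Coord n →L[ℝ] Coord n →L[ℝ] ℝ} {V : Set (Coord n)}
  {f ν : Coord m → Coord n} {U : Set (Coord m)} {ε lam : ℝ}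
  (hf : IsLocalHypersurface G V f ν U ε) {y : Coord m} (hy : y ∈ U)

include hf hy

/-- The tangential part of `Δ(φ ν) = λ φ ν` reads `(A + φ / (2 a)) ∇φ = 0`, and `A` has no real
eigenvalue. -/
theorem fderiv_meanCurvature_eq_zero {c : ℝ} (hc : HasConstantCurvature G V c)
    {φ : Coord m → ℝ} {a : ℝ} (ha : a ≠ 0)
    (hφ : ∀ z ∈ U, φ z = a * LinearMap.trace ℝ (Coord m) (shapeOp G f ν z).toLinearMap)
    (hlap : laplacian G f (fun z => φ z • ν z) y = lam • ν y)
    (hev : ∀ (r : ℝ) (v : Coord m), shapeOp G f ν y v = r • v → v = 0) :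
    fderiv ℝ φ y = 0 := by
  have hφ' : ∀ z ∈ U, φ =ᶠ[nhds z]
      fun z => a * LinearMap.trace ℝ (Coord m) (shapeOp G f ν z).toLinearMap := fun z hz => by
    filter_upwards [hf.mem_nhds hz] with x hx using hφ x hx
  have hφs : ∀ z ∈ U, ContDiffAt ℝ ∞ φ z := fun z hz =>
    (contDiffAt_const.mul (contDiffAt_trace (hf.contDiffAt_shapeOp hz))).congr_of_eventuallyEq
      (hφ' z hz)
  have hdφ : ∀ w, fderiv ℝ φ y w =
      a * LinearMap.trace ℝ (Coord m) (fderiv ℝ (shapeOp G f ν) y w).toLinearMap := by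
    intro w
    rw [(hφ' y hy).fderiv_eq, ← fderiv_trace (hf.differentiableAt_shapeOp hy),
      fderiv_const_mul ((contDiffAt_trace (hf.contDiffAt_shapeOp hy)).differentiableAt (by simp)),
      smul_apply, smul_eq_mul]
  have htan : ∀ w, fderiv ℝ φ y (shapeOp G f ν y w + (φ y / (2 * a)) • w) = 0 := by
    intro w
    have hlapw := hf.inner_laplacian_smul_normal_fderiv hy hφs hc w
    rw [hlap, map_smul, smul_apply, hf.normal y hy, smul_zero] at hlapw
    rw [map_add, map_smul, hdφ w, smul_eq_mul]
    field_simp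
    linarith
  let B : Coord m →ₗ[ℝ] Coord m := (shapeOp G f ν y).toLinearMap + (φ y / (2 * a)) • LinearMap.id
  have hB : Function.Injective B := by
    refine (injective_iff_map_eq_zero B).2 fun v hv => hev (-(φ y / (2 * a))) v ?_
    rw [neg_smul]
    exact eq_neg_of_add_eq_zero_left hv
  ext w
  obtain ⟨v, rfl⟩ := LinearMap.injective_iff_surjective.1 hB w
  exact htan v

theorem trace_sq_shapeOp {H : ℝ} (hH : H ≠ 0)
    (hlap : laplacian G f (fun z => H • ν z) y = lam • H • ν y) :
    LinearMap.trace ℝ (Coord m) (shapeOp G f ν y ∘L shapeOp G f ν y).toLinearMap = ε * lam := by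
  have hnormal := hf.inner_laplacian_smul_normal_normal hy (φ := fun _ => H)
    (fun _ _ => contDiffAt_const) (by simp)
  rw [hlap, map_smul, map_smul, smul_apply, smul_apply, hf.inner_self y hy, smul_eq_mul,
    smul_eq_mul] at hnormal
  apply mul_left_cancel₀ hH
  linarith

end MeanCurvature

end IsLocalHypersurface

end EndomorphismField

/-! ### Isometries -/

section Naturality

variable {E F : Type*} [NormedAddCommGroup E] [NormedSpace ℝ E]
  [NormedAddCommGroup F] [NormedSpace ℝ F]

theorem fderiv_fderiv_of_comp_eventuallyEq {E' F' : Type*} [NormedAddCommGroup E']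
    [NormedSpace ℝ E'] [NormedAddCommGroup F'] [NormedSpace ℝ F'] {f₀ : E → F} {f₁ : E' → F'}
    {σ : F → F'} {τ : E → E'} {y : E} (hσ : DifferentiableAt ℝ σ (f₀ y))
    (hf₀ : DifferentiableAt ℝ f₀ y) (hf₁ : DifferentiableAt ℝ f₁ (τ y))
    (hτ : DifferentiableAt ℝ τ y) (hf : σ ∘ f₀ =ᶠ[nhds y] f₁ ∘ τ) (u : E) :
    fderiv ℝ σ (f₀ y) (fderiv ℝ f₀ y u) = fderiv ℝ f₁ (τ y) (fderiv ℝ τ y u) := by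
  have h := hf.fderiv_eq (𝕜 := ℝ)
  rw [fderiv_comp y hσ hf₀, fderiv_comp y hf₁ hτ] at h
  exact DFunLike.congr_fun h u

variable [FiniteDimensional ℝ F] {G₀ G₁ : F → F →L[ℝ] F →L[ℝ] ℝ} {V₀ V₁ : Set F} {σ : F → F}

theorem fderiv_christoffel_of_isometry (hG₀ : IsLocalMetric G₀ V₀) (hG₁ : IsLocalMetric G₁ V₁)
    {z : F} (hz : z ∈ V₀) (hσz : σ z ∈ V₁) (hσ : ContDiffAt ℝ ∞ σ z)
    (hiso : G₀ =ᶠ[nhds z] pullbackMetric G₁ σ) (u v : F) :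
    fderiv ℝ σ z (christoffel G₀ z u v) =
      christoffel G₁ (σ z) (fderiv ℝ σ z u) (fderiv ℝ σ z v) + fderiv ℝ (fderiv ℝ σ) z u v := by
  have hval : ∀ a b, G₀ z a b = G₁ (σ z) (fderiv ℝ σ z a) (fderiv ℝ σ z b) := fun a b => by
    rw [hiso.eq_of_nhds, pullbackMetric_apply]
  have hinj : Function.Injective (fderiv ℝ σ z).toLinearMap :=
    (injective_iff_map_eq_zero _).2 fun a ha => hG₀.nondegenerate z hz a fun b => by
      rw [hval, show fderiv ℝ σ z a = 0 from ha, map_zero, zero_apply]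
  refine hG₁.ext_inner hσz fun w => ?_
  obtain ⟨w, rfl⟩ := LinearMap.injective_iff_surjective.1 hinj w
  have hkoszul : koszul G₀ z = koszul (pullbackMetric G₁ σ) z := by
    simp only [koszul, hiso.fderiv_eq]
  rw [ContinuousLinearMap.coe_coe, ← hval, hG₀.inner_christoffel hz, hkoszul,
    koszul_pullbackMetric hG₁ hσz hσ, map_add, add_apply, hG₁.inner_christoffel hσz]

variable {f₀ f₁ s₀ s₁ : E → F} {τ : E → E} {y : E}

theorem fderiv_covDerivAlong_of_isometry (hG₀ : IsLocalMetric G₀ V₀) (hG₁ : IsLocalMetric G₁ V₁)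
    (hy : f₀ y ∈ V₀) (hσy : σ (f₀ y) ∈ V₁) (hσ : ContDiffAt ℝ ∞ σ (f₀ y))
    (hiso : G₀ =ᶠ[nhds (f₀ y)] pullbackMetric G₁ σ)
    (hf₀ : DifferentiableAt ℝ f₀ y) (hf₁ : DifferentiableAt ℝ f₁ (τ y))
    (hs₀ : DifferentiableAt ℝ s₀ y) (hs₁ : DifferentiableAt ℝ s₁ (τ y))
    (hτ : DifferentiableAt ℝ τ y) (hf : σ ∘ f₀ =ᶠ[nhds y] f₁ ∘ τ)
    (hs : (fun z => fderiv ℝ σ (f₀ z) (s₀ z)) =ᶠ[nhds y] s₁ ∘ τ) (u : E) :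
    fderiv ℝ σ (f₀ y) (covDerivAlong G₀ f₀ s₀ y u) =
      covDerivAlong G₁ f₁ s₁ (τ y) (fderiv ℝ τ y u) := by
  have hdσ : DifferentiableAt ℝ (fderiv ℝ σ) (f₀ y) :=
    (contDiffAt_fderiv hσ).differentiableAt (by simp)
  have hdf := fderiv_fderiv_of_comp_eventuallyEq (hσ.differentiableAt (by simp)) hf₀ hf₁ hτ hf u
  have hds : fderiv ℝ (fderiv ℝ σ) (f₀ y) (fderiv ℝ f₀ y u) (s₀ y)
      + fderiv ℝ σ (f₀ y) (fderiv ℝ s₀ y u) = fderiv ℝ s₁ (τ y) (fderiv ℝ τ y u) := by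
    have h := hs.fderiv_eq (𝕜 := ℝ)
    rw [fderiv_comp y hs₁ hτ,
      fderiv_clm_apply (c := fun z => fderiv ℝ σ (f₀ z)) (hdσ.comp y hf₀) hs₀,
      fderiv_fun_comp y hdσ hf₀] at h
    rw [add_comm]
    exact DFunLike.congr_fun h u
  have hf_y : σ (f₀ y) = f₁ (τ y) := hf.eq_of_nhds
  have hs_y : fderiv ℝ σ (f₀ y) (s₀ y) = s₁ (τ y) := hs.eq_of_nhds
  rw [covDerivAlong_apply, covDerivAlong_apply, map_add,
    fderiv_christoffel_of_isometry hG₀ hG₁ hy hσy hσ hiso, hdf, hs_y, hf_y, ← hds]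
  abel

variable [FiniteDimensional ℝ E]

theorem fderiv_shapeOp_of_isometry {ν₀ ν₁ : E → F} {U₀ U₁ : Set E} {ε : ℝ}
    (hf₀ : IsLocalHypersurface G₀ V₀ f₀ ν₀ U₀ ε) (hf₁ : IsLocalHypersurface G₁ V₁ f₁ ν₁ U₁ ε)
    (hy : y ∈ U₀) (hτy : τ y ∈ U₁) (hσ : ContDiffAt ℝ ∞ σ (f₀ y))
    (hiso : G₀ =ᶠ[nhds (f₀ y)] pullbackMetric G₁ σ) (hτ : DifferentiableAt ℝ τ y)
    (hf : σ ∘ f₀ =ᶠ[nhds y] f₁ ∘ τ)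
    (hν : (fun z => fderiv ℝ σ (f₀ z) (ν₀ z)) =ᶠ[nhds y] ν₁ ∘ τ) (u : E) :
    fderiv ℝ τ y (shapeOp G₀ f₀ ν₀ y u) = shapeOp G₁ f₁ ν₁ (τ y) (fderiv ℝ τ y u) := by
  have hf_y : σ (f₀ y) = f₁ (τ y) := hf.eq_of_nhds
  have hdf := fderiv_fderiv_of_comp_eventuallyEq (hσ.differentiableAt (by simp))
    (hf₀.differentiableAt_map hy) (hf₁.differentiableAt_map hτy) hτ hf
  have h := fderiv_covDerivAlong_of_isometry hf₀.metric hf₁.metric (hf₀.mapsTo hy)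
    (hf_y ▸ hf₁.mapsTo hτy) hσ hiso (hf₀.differentiableAt_map hy) (hf₁.differentiableAt_map hτy)
    (hf₀.differentiableAt_normal hy) (hf₁.differentiableAt_normal hτy) hτ hf hν u
  rw [hf₀.weingarten_formula hy, hf₁.weingarten_formula hτy, map_neg, neg_inj, hdf] at h
  exact hf₁.fderiv_injective hτy h

end Naturality

/-! ### Charts -/

section Charts

variable {n : ℕ} {N : Type*} [TopologicalSpace N] [ChartedSpace (EuclideanSpace ℝ (Fin n)) N]

/-- The derivative at `q` of the chart around `q₀`, as an endomorphism of the model space: the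
tangent space at `q` is read as the model space, to which it is definitionally equal. -/
def chartDeriv (q₀ q : N) : Coord n →L[ℝ] Coord n :=
  mfderiv (𝓡 n) (𝓡 n) (extChartAt (𝓡 n) q₀) q

/-- The derivative at `z` of the inverse of the chart around `q₀`, as an endomorphism of the model
space. -/
def chartSymmDeriv (q₀ : N) (z : Coord n) : Coord n →L[ℝ] Coord n :=
  mfderiv (𝓡 n) (𝓡 n) (extChartAt (𝓡 n) q₀).symm z

/-- The transition map from the chart around `q₀` to the chart around `q₁`. -/
def chartTransition (q₀ q₁ : N) (z : Coord n) : Coord n :=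
  extChartAt (𝓡 n) q₁ ((extChartAt (𝓡 n) q₀).symm z)

theorem extChartAt_symm_chartTransition {q₀ q₁ : N} {z : Coord n}
    (hz : (extChartAt (𝓡 n) q₀).symm z ∈ (extChartAt (𝓡 n) q₁).source) :
    (extChartAt (𝓡 n) q₁).symm (chartTransition q₀ q₁ z) = (extChartAt (𝓡 n) q₀).symm z :=
  (extChartAt (𝓡 n) q₁).left_inv hz

variable [IsManifold (𝓡 n) ∞ N]

theorem chartDeriv_self (q : N) : chartDeriv q q = ContinuousLinearMap.id ℝ (Coord n) :=
  mfderiv_extChartAt_self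

theorem chartSymmDeriv_chartDeriv {q₀ q : N} (hq : q ∈ (extChartAt (𝓡 n) q₀).source)
    (v : Coord n) : chartSymmDeriv q₀ (extChartAt (𝓡 n) q₀ q) (chartDeriv q₀ q v) = v := by
  have h := mfderivWithin_extChartAt_symm_comp_mfderiv_extChartAt' hq
  rw [ModelWithCorners.range_eq_univ, mfderivWithin_univ] at h
  exact DFunLike.congr_fun h v

theorem mdifferentiableAt_extChartAt_of_mem_source {q₀ q : N}
    (hq : q ∈ (extChartAt (𝓡 n) q₀).source) :
    MDifferentiableAt (𝓡 n) (𝓡 n) (extChartAt (𝓡 n) q₀) q :=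
  mdifferentiableAt_extChartAt (by rwa [extChartAt_source] at hq)

section Target

variable {q₀ : N} {z : Coord n} (hz : z ∈ (extChartAt (𝓡 n) q₀).target)

include hz

theorem chartDeriv_chartSymmDeriv (v : Coord n) :
    chartDeriv q₀ ((extChartAt (𝓡 n) q₀).symm z) (chartSymmDeriv q₀ z v) = v := by
  have h := mfderiv_extChartAt_comp_mfderivWithin_extChartAt_symm hz
  rw [ModelWithCorners.range_eq_univ, mfderivWithin_univ] at h
  exact DFunLike.congr_fun h v

theorem chartSymmDeriv_injective : Function.Injective (chartSymmDeriv q₀ z) :=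
  Function.LeftInverse.injective (chartDeriv_chartSymmDeriv hz)

theorem chartSymmDeriv_surjective : Function.Surjective (chartSymmDeriv q₀ z) := fun v => by
  have h := chartSymmDeriv_chartDeriv ((extChartAt (𝓡 n) q₀).map_target hz) v
  rw [(extChartAt (𝓡 n) q₀).right_inv hz] at h
  exact ⟨_, h⟩

theorem contMDiffAt_extChartAt_symm :
    ContMDiffAt (𝓡 n) (𝓡 n) ∞ (extChartAt (𝓡 n) q₀).symm z :=
  (contMDiffOn_extChartAt_symm q₀).contMDiffAt ((isOpen_extChartAt_target q₀).mem_nhds hz)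

theorem mdifferentiableAt_extChartAt_symm :
    MDifferentiableAt (𝓡 n) (𝓡 n) (extChartAt (𝓡 n) q₀).symm z :=
  (contMDiffAt_extChartAt_symm hz).mdifferentiableAt (by simp)

variable {q₁ : N} (hz' : (extChartAt (𝓡 n) q₀).symm z ∈ (extChartAt (𝓡 n) q₁).source)

include hz'

theorem contDiffAt_chartTransition : ContDiffAt ℝ ∞ (chartTransition q₀ q₁) z := by
  rw [← contMDiffAt_iff_contDiffAt]
  exact ContMDiffAt.comp (I' := 𝓡 n) z
    (contMDiffAt_extChartAt' (by rwa [extChartAt_source] at hz')) (contMDiffAt_extChartAt_symm hz)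

theorem fderiv_chartTransition (v : Coord n) :
    fderiv ℝ (chartTransition q₀ q₁) z v =
      chartDeriv q₁ ((extChartAt (𝓡 n) q₀).symm z) (chartSymmDeriv q₀ z v) := by
  rw [← mfderiv_eq_fderiv]
  exact DFunLike.congr_fun (mfderiv_comp (I := 𝓡 n) (I' := 𝓡 n) (I'' := 𝓡 n) z
    (mdifferentiableAt_extChartAt_of_mem_source hz') (mdifferentiableAt_extChartAt_symm hz)) v

theorem eventually_mem_target_and_mem_source :
    ∀ᶠ w in nhds z, w ∈ (extChartAt (𝓡 n) q₀).target ∧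
      (extChartAt (𝓡 n) q₀).symm w ∈ (extChartAt (𝓡 n) q₁).source :=
  Filter.Eventually.and ((isOpen_extChartAt_target q₀).mem_nhds hz)
    ((contMDiffAt_extChartAt_symm hz).continuousAt.preimage_mem_nhds
      ((isOpen_extChartAt_source q₁).mem_nhds hz'))

theorem chartSymmDeriv_chartTransition (v : Coord n) :
    chartSymmDeriv q₁ (chartTransition q₀ q₁ z) (fderiv ℝ (chartTransition q₀ q₁) z v) =
      chartSymmDeriv q₀ z v := by
  rw [fderiv_chartTransition hz hz']
  exact chartSymmDeriv_chartDeriv hz' _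

theorem fderiv_chartTransition_injective :
    Function.Injective (fderiv ℝ (chartTransition q₀ q₁) z) := by
  refine Function.Injective.of_comp (f := chartSymmDeriv q₁ (chartTransition q₀ q₁ z)) ?_
  rw [show _ ∘ _ = ⇑(chartSymmDeriv q₀ z) from
    funext fun v => chartSymmDeriv_chartTransition hz hz' v]
  exact chartSymmDeriv_injective hz

end Target

end Charts

end LocalGeometry

open LocalGeometry

namespace PseudoRiemannianMetric

variable {n : ℕ} {N : Type*} [TopologicalSpace N] [ChartedSpace (EuclideanSpace ℝ (Fin n)) N]
  (g : PseudoRiemannianMetric n N)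

/-- The scalar product on the tangent space at `q`, as a bilinear form on the model space. -/
def coordInner (q : N) : Coord n →L[ℝ] Coord n →L[ℝ] ℝ := g.inner q

theorem inChart_apply (q₀ : N) (z u v : Coord n) :
    g.inChart q₀ z u v = g.coordInner ((extChartAt (𝓡 n) q₀).symm z) (chartSymmDeriv q₀ z u)
      (chartSymmDeriv q₀ z v) := rfl

variable [IsManifold (𝓡 n) ∞ N]

theorem isLocalMetric_inChart (q₀ : N) :
    IsLocalMetric (g.inChart q₀) (extChartAt (𝓡 n) q₀).target where
  isOpen := isOpen_extChartAt_target q₀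
  contDiffAt _ hz := (g.smooth q₀).contDiffAt ((isOpen_extChartAt_target q₀).mem_nhds hz)
  symm _ _ _ _ := g.symm _ _ _
  nondegenerate z hz u hu := by
    refine (map_eq_zero_iff _ (chartSymmDeriv_injective hz)).1
      (g.nondegenerate ((extChartAt (𝓡 n) q₀).symm z) _ fun v => ?_)
    obtain ⟨v, rfl⟩ := chartSymmDeriv_surjective hz v
    exact hu v

theorem inChart_eventuallyEq {q₀ q₁ : N} {z : Coord n} (hz : z ∈ (extChartAt (𝓡 n) q₀).target)
    (hz' : (extChartAt (𝓡 n) q₀).symm z ∈ (extChartAt (𝓡 n) q₁).source) :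
    g.inChart q₀ =ᶠ[nhds z] pullbackMetric (g.inChart q₁) (chartTransition q₀ q₁) := by
  filter_upwards [eventually_mem_target_and_mem_source hz hz'] with w hw
  ext u v
  rw [pullbackMetric_apply, inChart_apply, inChart_apply, chartSymmDeriv_chartTransition hw.1 hw.2,
    chartSymmDeriv_chartTransition hw.1 hw.2, extChartAt_symm_chartTransition hw.2]

variable {g}

theorem HasConstantSectionalCurvature.hasConstantCurvature_inChart {c : ℝ}
    (hc : g.HasConstantSectionalCurvature c) (hn : 2 ≤ n) (q₀ : N) :
    HasConstantCurvature (g.inChart q₀) (extChartAt (𝓡 n) q₀).target c := fun z hz u v w =>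
  (g.isLocalMetric_inChart q₀).curvature_eq_of_sectional hz (by simpa using hn) (hc q₀ z hz) u v w

end PseudoRiemannianMetric

section Immersion

variable {m n : ℕ} {M : Type*} [TopologicalSpace M] [ChartedSpace (EuclideanSpace ℝ (Fin m)) M]
  {N : Type*} [TopologicalSpace N] [ChartedSpace (EuclideanSpace ℝ (Fin n)) N]

/-- The domain of the coordinate expression of `x : M → N` near `p₀`. -/
def mapChartDomain (x : M → N) (p₀ : M) : Set (Coord m) :=
  (extChartAt (𝓡 m) p₀).target ∩
    (extChartAt (𝓡 m) p₀).symm ⁻¹' (x ⁻¹' (extChartAt (𝓡 n) (x p₀)).source)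

variable (m n) in
/-- The derivative of `x : M → N` at `p`, as a linear map between the model spaces. -/
def coordDeriv (x : M → N) (p : M) : Coord m →L[ℝ] Coord n :=
  mfderiv (𝓡 m) (𝓡 n) x p

variable {x : M → N}

theorem extChartAt_self_mem_mapChartDomain (p : M) :
    extChartAt (𝓡 m) p p ∈ mapChartDomain (n := n) x p := by
  refine ⟨mem_extChartAt_target p, ?_⟩
  rw [Set.mem_preimage, extChartAt_to_inv]
  exact mem_extChartAt_source (x p)

theorem isOpen_mapChartDomain (hx : Continuous x) (p₀ : M) :
    IsOpen (mapChartDomain (m := m) (n := n) x p₀) :=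
  (continuousOn_extChartAt_symm p₀).isOpen_inter_preimage (isOpen_extChartAt_target p₀)
    ((isOpen_extChartAt_source _).preimage hx)

theorem mapInChart_mem_target {p₀ : M} {y : Coord m} (hy : y ∈ mapChartDomain (n := n) x p₀) :
    mapInChart x p₀ y ∈ (extChartAt (𝓡 n) (x p₀)).target :=
  (extChartAt (𝓡 n) (x p₀)).map_source hy.2

theorem map_mem_chartAt_source {p₀ : M} {y : Coord m} (hy : y ∈ mapChartDomain (n := n) x p₀) :
    x ((extChartAt (𝓡 m) p₀).symm y) ∈ (chartAt (Coord n) (x p₀)).source := by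
  rw [← extChartAt_source (𝓡 n)]
  exact hy.2

theorem extChartAt_symm_mapInChart {p₀ : M} {y : Coord m}
    (hy : y ∈ mapChartDomain (n := n) x p₀) :
    (extChartAt (𝓡 n) (x p₀)).symm (mapInChart x p₀ y) = x ((extChartAt (𝓡 m) p₀).symm y) :=
  (extChartAt (𝓡 n) (x p₀)).left_inv hy.2

theorem fieldInChart_apply (s : ∀ p : M, TangentSpace (𝓡 n) (x p)) (p₀ : M) (y : Coord m) :
    fieldInChart x s p₀ y = chartDeriv (x p₀) (x ((extChartAt (𝓡 m) p₀).symm y))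
      (s ((extChartAt (𝓡 m) p₀).symm y)) := rfl

variable [IsManifold (𝓡 n) ∞ N]

theorem chartSymmDeriv_fieldInChart (s : ∀ p : M, TangentSpace (𝓡 n) (x p)) {p₀ : M} {y : Coord m}
    (hy : y ∈ mapChartDomain (n := n) x p₀) :
    chartSymmDeriv (x p₀) (mapInChart x p₀ y) (fieldInChart x s p₀ y) =
      s ((extChartAt (𝓡 m) p₀).symm y) :=
  chartSymmDeriv_chartDeriv hy.2 _

variable [IsManifold (𝓡 m) ∞ M] {g : PseudoRiemannianMetric n N}
  {ξ : ∀ p : M, TangentSpace (𝓡 n) (x p)} {ε : ℝ} {p₀ : M} {y : Coord m}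
  (hy : y ∈ mapChartDomain (n := n) x p₀)

include hy

theorem contDiffAt_mapInChart (hx : ContMDiff (𝓡 m) (𝓡 n) ∞ x) :
    ContDiffAt ℝ ∞ (mapInChart (m := m) (n := n) x p₀) y := by
  rw [← contMDiffAt_iff_contDiffAt]
  exact ContMDiffAt.comp (I' := 𝓡 n) y
    (contMDiffAt_extChartAt' (map_mem_chartAt_source hy))
    (ContMDiffAt.comp (I' := 𝓡 m) y (hx _) (contMDiffAt_extChartAt_symm hy.1))

theorem chartSymmDeriv_fderiv_mapInChart (hx : ContMDiff (𝓡 m) (𝓡 n) ∞ x) (v : Coord m) :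
    chartSymmDeriv (x p₀) (mapInChart x p₀ y) (fderiv ℝ (mapInChart x p₀) y v) =
      coordDeriv m n x ((extChartAt (𝓡 m) p₀).symm y) (chartSymmDeriv p₀ y v) := by
  have hxd := (hx ((extChartAt (𝓡 m) p₀).symm y)).mdifferentiableAt (by simp)
  have hsymm := mdifferentiableAt_extChartAt_symm hy.1
  have hchain := mfderiv_comp (I := 𝓡 m) (I' := 𝓡 n) (I'' := 𝓡 n) y
    (g := extChartAt (𝓡 n) (x p₀)) (f := x ∘ (extChartAt (𝓡 m) p₀).symm)
    (mdifferentiableAt_extChartAt_of_mem_source hy.2)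
    (MDifferentiableAt.comp (I := 𝓡 m) (I' := 𝓡 m) (I'' := 𝓡 n) y hxd hsymm)
  rw [mfderiv_comp (I := 𝓡 m) (I' := 𝓡 m) (I'' := 𝓡 n) y hxd hsymm] at hchain
  rw [← mfderiv_eq_fderiv]
  exact (congrArg (chartSymmDeriv (x p₀) (mapInChart x p₀ y)) (DFunLike.congr_fun hchain v)).trans
    (chartSymmDeriv_chartDeriv hy.2 _)

theorem contDiffAt_fieldInChart (hx : Continuous x)
    (hξ : ContMDiff (𝓡 m) (𝓡 n).tangent ∞ (fun p => (⟨x p, ξ p⟩ : TangentBundle (𝓡 n) N))) :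
    ContDiffAt ℝ ∞ (fieldInChart (m := m) x ξ p₀) y := by
  rw [← contMDiffAt_iff_contDiffAt]
  let e := trivializationAt (Coord n) (TangentSpace (𝓡 n)) (x p₀)
  have hbase : ∀ z ∈ mapChartDomain (n := n) x p₀,
      x ((extChartAt (𝓡 m) p₀).symm z) ∈ e.baseSet := fun z hz => by
    simpa [e] using map_mem_chartAt_source hz
  have hsnd := ((e.contMDiffAt_iff (n := ∞) (e.mem_source.2 (hbase y hy))).1
    (hξ ((extChartAt (𝓡 m) p₀).symm y))).2
  refine (ContMDiffAt.comp (I' := 𝓡 m) y hsnd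
    (contMDiffAt_extChartAt_symm hy.1)).congr_of_eventuallyEq ?_
  filter_upwards [(isOpen_mapChartDomain hx p₀).mem_nhds hy] with z hz
  have h := e.continuousLinearMapAt_apply_of_mem ℝ (hbase z hz) (ξ ((extChartAt (𝓡 m) p₀).symm z))
  rwa [TangentBundle.continuousLinearMapAt_trivializationAt (map_mem_chartAt_source hz)] at h

omit hy

theorem isLocalHypersurface_inChart (hmn : n = m + 1) (hx : IsNondegenerateImmersion m g x)
    (hξ : IsUnitNormal m g x ξ ε) (p₀ : M) :
    IsLocalHypersurface (g.inChart (x p₀)) (extChartAt (𝓡 n) (x p₀)).target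
      (mapInChart (m := m) x p₀) (fieldInChart x ξ p₀) (mapChartDomain (n := n) x p₀) ε where
  metric := g.isLocalMetric_inChart (x p₀)
  isOpen := isOpen_mapChartDomain hx.smooth.continuous p₀
  mapsTo _ := mapInChart_mem_target
  contDiffAt_map _ hy := contDiffAt_mapInChart hy hx.smooth
  contDiffAt_normal _ hy := contDiffAt_fieldInChart hy hx.smooth.continuous hξ.smooth
  normal y hy u := by
    rw [g.inChart_apply, chartSymmDeriv_fieldInChart ξ hy,
      chartSymmDeriv_fderiv_mapInChart hy hx.smooth, extChartAt_symm_mapInChart hy]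
    exact hξ.normal _ _
  inner_self y hy := by
    rw [g.inChart_apply, chartSymmDeriv_fieldInChart ξ hy, extChartAt_symm_mapInChart hy]
    exact hξ.inner_self _
  sign := hξ.sign
  nondegenerate y hy u hu := by
    refine (map_eq_zero_iff _ (chartSymmDeriv_injective hy.1)).1
      (hx.nondegenerate ((extChartAt (𝓡 m) p₀).symm y) _ fun v => ?_)
    obtain ⟨v, rfl⟩ := chartSymmDeriv_surjective hy.1 v
    have huv := hu v
    rw [pullbackMetric_apply, g.inChart_apply, chartSymmDeriv_fderiv_mapInChart hy hx.smooth,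
      chartSymmDeriv_fderiv_mapInChart hy hx.smooth, extChartAt_symm_mapInChart hy] at huv
    exact huv
  finrank_eq := by simp [hmn]

end Immersion

section ChartInvariance

variable {m n : ℕ} {M : Type*} [TopologicalSpace M] [ChartedSpace (EuclideanSpace ℝ (Fin m)) M]
  {N : Type*} [TopologicalSpace N] [ChartedSpace (EuclideanSpace ℝ (Fin n)) N]

/-- The shape operator in the coordinates around `p₀`. -/
def shapeOpInChart (g : PseudoRiemannianMetric n N) (x : M → N)
    (ξ : ∀ p : M, TangentSpace (𝓡 n) (x p)) (p₀ : M) (y : Coord m) : Coord m →L[ℝ] Coord m :=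
  shapeOp (g.inChart (x p₀)) (mapInChart x p₀) (fieldInChart x ξ p₀) y

/-- `shapeOperator`, as an endomorphism of the model space. -/
def coordShapeOperator (g : PseudoRiemannianMetric n N) (x : M → N)
    (ξ : ∀ p : M, TangentSpace (𝓡 n) (x p)) (p : M) : Module.End ℝ (Coord m) :=
  (shapeOpInChart (m := m) g x ξ p (extChartAt (𝓡 m) p p)).toLinearMap

section ChangeOfChart

variable {x : M → N} {p₀ p : M} {y : Coord m} (hy : y ∈ mapChartDomain (n := n) x p₀)
  (hp : (extChartAt (𝓡 m) p₀).symm y ∈ (extChartAt (𝓡 m) p).source)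

include hy hp

theorem chartTransition_mapInChart :
    chartTransition (n := n) (x p₀) (x p) (mapInChart x p₀ y) =
      mapInChart x p (chartTransition p₀ p y) := by
  rw [chartTransition, extChartAt_symm_mapInChart hy, mapInChart,
    extChartAt_symm_chartTransition hp]

variable (hxp : x ((extChartAt (𝓡 m) p₀).symm y) ∈ (extChartAt (𝓡 n) (x p)).source)

include hxp

omit hy in
theorem chartTransition_mem_mapChartDomain :
    chartTransition p₀ p y ∈ mapChartDomain (n := n) x p := by
  refine ⟨(extChartAt (𝓡 m) p).map_source hp, ?_⟩
  rwa [Set.mem_preimage, extChartAt_symm_chartTransition hp]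

theorem fderiv_chartTransition_fieldInChart [IsManifold (𝓡 n) ∞ N]
    (s : ∀ p : M, TangentSpace (𝓡 n) (x p)) :
    fderiv ℝ (chartTransition (x p₀) (x p)) (mapInChart x p₀ y) (fieldInChart x s p₀ y) =
      fieldInChart x s p (chartTransition p₀ p y) := by
  rw [fderiv_chartTransition (mapInChart_mem_target hy) (by rwa [extChartAt_symm_mapInChart hy]),
    chartSymmDeriv_fieldInChart s hy, extChartAt_symm_mapInChart hy, fieldInChart_apply,
    extChartAt_symm_chartTransition hp]

theorem eventually_mem_mapChartDomain [IsManifold (𝓡 m) ∞ M] (hx : Continuous x) :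
    ∀ᶠ z in nhds y, z ∈ mapChartDomain (n := n) x p₀ ∧
      (extChartAt (𝓡 m) p₀).symm z ∈ (extChartAt (𝓡 m) p).source ∧
      x ((extChartAt (𝓡 m) p₀).symm z) ∈ (extChartAt (𝓡 n) (x p)).source := by
  have hsymm := (contMDiffAt_extChartAt_symm hy.1).continuousAt
  filter_upwards [(isOpen_mapChartDomain hx p₀).mem_nhds hy,
    hsymm.preimage_mem_nhds ((isOpen_extChartAt_source p).mem_nhds hp),
    (hx.continuousAt.comp (x := y) hsymm).preimage_mem_nhds
      ((isOpen_extChartAt_source (x p)).mem_nhds hxp)] with z h₁ h₂ h₃ using ⟨h₁, h₂, h₃⟩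

variable [IsManifold (𝓡 m) ∞ M] [IsManifold (𝓡 n) ∞ N]

theorem fderiv_chartTransition_shapeOpInChart {g : PseudoRiemannianMetric n N}
    {ξ : ∀ p : M, TangentSpace (𝓡 n) (x p)} {ε : ℝ} (hmn : n = m + 1)
    (hx : IsNondegenerateImmersion m g x) (hξ : IsUnitNormal m g x ξ ε) (u : Coord m) :
    fderiv ℝ (chartTransition p₀ p) y (shapeOpInChart g x ξ p₀ y u) =
      shapeOpInChart g x ξ p (chartTransition p₀ p y) (fderiv ℝ (chartTransition p₀ p) y u) := by
  have htarget := mapInChart_mem_target hy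
  have hsource : (extChartAt (𝓡 n) (x p₀)).symm (mapInChart x p₀ y) ∈
      (extChartAt (𝓡 n) (x p)).source := by
    rwa [extChartAt_symm_mapInChart hy]
  have hev := eventually_mem_mapChartDomain hy hp hxp hx.smooth.continuous
  exact fderiv_shapeOp_of_isometry
    (isLocalHypersurface_inChart hmn hx hξ p₀) (isLocalHypersurface_inChart hmn hx hξ p) hy
    (chartTransition_mem_mapChartDomain hp hxp) (contDiffAt_chartTransition htarget hsource)
    (g.inChart_eventuallyEq htarget hsource)
    ((contDiffAt_chartTransition hy.1 hp).differentiableAt (by simp))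
    (hev.mono fun z hz => chartTransition_mapInChart hz.1 hz.2.1)
    (hev.mono fun z hz => fderiv_chartTransition_fieldInChart hz.1 hz.2.1 hz.2.2 ξ) u

end ChangeOfChart

variable [IsManifold (𝓡 n) ∞ N] {g : PseudoRiemannianMetric n N} {x : M → N}
  {ξ : ∀ p : M, TangentSpace (𝓡 n) (x p)} {ε : ℝ}

theorem meanCurvature_eq (hξ : IsUnitNormal m g x ξ ε) (p : M) :
    meanCurvature m g x ξ p =
      1 / (m : ℝ) * ε * LinearMap.trace ℝ (Coord m) (coordShapeOperator g x ξ p) := by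
  rw [← hξ.inner_self p]
  rfl

variable [IsManifold (𝓡 m) ∞ M] (hmn : n = m + 1) (hx : IsNondegenerateImmersion m g x)
  (hξ : IsUnitNormal m g x ξ ε) {p₀ : M} {y : Coord m} (hy : y ∈ mapChartDomain (n := n) x p₀)

include hmn hx hξ hy

theorem exists_conj_shapeOpInChart :
    ∃ e : Coord m ≃ₗ[ℝ] Coord m, coordShapeOperator g x ξ ((extChartAt (𝓡 m) p₀).symm y) =
      e.conj (shapeOpInChart g x ξ p₀ y).toLinearMap := by
  have hp := mem_extChartAt_source (I := 𝓡 m) ((extChartAt (𝓡 m) p₀).symm y)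
  let e := LinearEquiv.ofInjectiveEndo
    (fderiv ℝ (chartTransition p₀ ((extChartAt (𝓡 m) p₀).symm y)) y).toLinearMap
    (fderiv_chartTransition_injective hy.1 hp)
  refine ⟨e, LinearMap.ext fun v => ?_⟩
  obtain ⟨u, rfl⟩ := e.surjective v
  rw [LinearEquiv.conj_apply_apply, LinearEquiv.symm_apply_apply]
  exact (fderiv_chartTransition_shapeOpInChart hy hp (mem_extChartAt_source _) hmn hx hξ u).symm

theorem meanCurvature_extChartAt_symm :
    meanCurvature m g x ξ ((extChartAt (𝓡 m) p₀).symm y) =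
      1 / (m : ℝ) * ε * LinearMap.trace ℝ (Coord m) (shapeOpInChart g x ξ p₀ y).toLinearMap := by
  obtain ⟨e, he⟩ := exists_conj_shapeOpInChart hmn hx hξ hy
  rw [meanCurvature_eq hξ, he, LinearMap.trace_conj']

end ChartInvariance

theorem isLocallyConstant_of_hasMFDerivAt_zero {m : ℕ} {M : Type*} [TopologicalSpace M]
    [ChartedSpace (EuclideanSpace ℝ (Fin m)) M] [IsManifold (𝓡 m) ∞ M] {F : Type*}
    [NormedAddCommGroup F] [NormedSpace ℝ F] {φ : M → F}
    (hφ : ∀ p, HasMFDerivAt (𝓡 m) 𝓘(ℝ, F) φ p 0) : IsLocallyConstant φ := by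
  refine (IsLocallyConstant.iff_eventually_eq _).2 fun p => ?_
  have hderiv : ∀ z ∈ (extChartAt (𝓡 m) p).target,
      HasFDerivAt (φ ∘ (extChartAt (𝓡 m) p).symm) (0 : Coord m →L[ℝ] F) z := fun z hz =>
    ((hφ _).comp z (mdifferentiableAt_extChartAt_symm hz).hasMFDerivAt).hasFDerivAt
  obtain ⟨r, hr, hball⟩ := Metric.isOpen_iff.1 (isOpen_extChartAt_target (I := 𝓡 m) p)
    (extChartAt (𝓡 m) p p) (mem_extChartAt_target p)
  filter_upwards [(continuousAt_extChartAt (I := 𝓡 m) p).preimage_mem_nhds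
    (Metric.ball_mem_nhds _ hr), extChartAt_source_mem_nhds (I := 𝓡 m) p] with q hq hq'
  have h := Metric.isOpen_ball.is_const_of_fderiv_eq_zero (𝕜 := ℝ)
    (convex_ball (extChartAt (𝓡 m) p p) r).isPreconnected
    (fun z hz => (hderiv z (hball hz)).differentiableAt.differentiableWithinAt)
    (fun z hz => (hderiv z (hball hz)).fderiv) hq (Metric.mem_ball_self hr)
  simpa only [Function.comp_apply, (extChartAt (𝓡 m) p).left_inv hq', extChartAt_to_inv] using h

/-! ### Hypersurfaces with proper mean curvature vector field -/

section ProperMeanCurvature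

variable {m n : ℕ} {M : Type*} [TopologicalSpace M] [ChartedSpace (EuclideanSpace ℝ (Fin m)) M]
  {N : Type*} [TopologicalSpace N] [ChartedSpace (EuclideanSpace ℝ (Fin n)) N]
  [IsManifold (𝓡 n) ∞ N] {g : PseudoRiemannianMetric n N} {x : M → N}
  {ξ : ∀ p : M, TangentSpace (𝓡 n) (x p)} {ε c lam : ℝ}

theorem laplacian_meanCurvatureVector (hlam : HasProperMeanCurvature m g x ξ lam) (p : M) :
    laplacian (g.inChart (x p)) (mapInChart x p)
        (fun z => meanCurvature m g x ξ ((extChartAt (𝓡 m) p).symm z) •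
          fieldInChart (m := m) x ξ p z) (extChartAt (𝓡 m) p p) =
      lam • meanCurvature m g x ξ p • fieldInChart (m := m) x ξ p (extChartAt (𝓡 m) p p) := by
  have hfield : fieldInChart x (meanCurvatureVector m g x ξ) p =
      fun z => meanCurvature m g x ξ ((extChartAt (𝓡 m) p).symm z) •
        fieldInChart (m := m) x ξ p z :=
    funext fun z => (chartDeriv (x p) (x ((extChartAt (𝓡 m) p).symm z))).map_smul _ _
  have hcenter : fieldInChart (m := m) x ξ p (extChartAt (𝓡 m) p p) = ξ p := by
    rw [fieldInChart_apply, extChartAt_to_inv, chartDeriv_self]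
    rfl
  rw [← hfield, hcenter]
  exact hlam p

variable [IsManifold (𝓡 m) ∞ M]

theorem hasMFDerivAt_meanCurvature_zero (hm : m ≠ 0) (hmn : n = m + 1)
    (hc : g.HasConstantSectionalCurvature c) (hx : IsNondegenerateImmersion m g x)
    (hξ : IsUnitNormal m g x ξ ε) (hlam : HasProperMeanCurvature m g x ξ lam) {p : M}
    (him : ∀ μ ∈ principalCurvatures m g x ξ p, μ.im ≠ 0) :
    HasMFDerivAt (𝓡 m) 𝓘(ℝ, ℝ) (meanCurvature m g x ξ) p 0 := by
  have hf := isLocalHypersurface_inChart hmn hx hξ p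
  have hε := hf.sign_ne_zero
  have hy := extChartAt_self_mem_mapChartDomain (m := m) (n := n) (x := x) p
  have htrace := fun z hz => meanCurvature_extChartAt_symm (p₀ := p) (y := z) hmn hx hξ hz
  have hlap := laplacian_meanCurvatureVector hlam p
  rw [smul_smul] at hlap
  have hzero := hf.fderiv_meanCurvature_eq_zero hy (hc.hasConstantCurvature_inChart (by lia) (x p))
    (by positivity) htrace hlap fun r v hv => eq_zero_of_apply_eq_smul him hv
  have hdiff : DifferentiableAt ℝ
      (fun z => meanCurvature m g x ξ ((extChartAt (𝓡 m) p).symm z)) (extChartAt (𝓡 m) p p) := by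
    refine (((contDiffAt_const (c := 1 / (m : ℝ) * ε)).mul (contDiffAt_trace
      (hf.contDiffAt_shapeOp hy))).differentiableAt (by simp)).congr_of_eventuallyEq ?_
    filter_upwards [hf.mem_nhds hy] with z hz using htrace z hz
  have hderiv := hdiff.hasFDerivAt
  rw [hzero] at hderiv
  refine (hderiv.hasMFDerivAt.comp p
    (mdifferentiableAt_extChartAt_of_mem_source (mem_extChartAt_source p)).hasMFDerivAt
    ).congr_of_eventuallyEq ?_
  filter_upwards [extChartAt_source_mem_nhds (I := 𝓡 m) p] with q hq
  rw [Function.comp_apply, (extChartAt (𝓡 m) p).left_inv hq]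

theorem meanCurvature_eq_of_hasProperMeanCurvature [ConnectedSpace M] (hm : m ≠ 0)
    (hmn : n = m + 1) (hc : g.HasConstantSectionalCurvature c)
    (hx : IsNondegenerateImmersion m g x) (hξ : IsUnitNormal m g x ξ ε)
    (hlam : HasProperMeanCurvature m g x ξ lam)
    (him : ∀ p : M, ∀ μ ∈ principalCurvatures m g x ξ p, μ.im ≠ 0) (p q : M) :
    meanCurvature m g x ξ p = meanCurvature m g x ξ q :=
  (isLocallyConstant_of_hasMFDerivAt_zero fun r =>
    hasMFDerivAt_meanCurvature_zero hm hmn hc hx hξ hlam (him r)).apply_eq_of_preconnectedSpace p q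

theorem trace_sq_coordShapeOperator (hmn : n = m + 1) (hx : IsNondegenerateImmersion m g x)
    (hξ : IsUnitNormal m g x ξ ε) (hlam : HasProperMeanCurvature m g x ξ lam) {H : ℝ} (hH : H ≠ 0)
    (hconst : ∀ p : M, meanCurvature m g x ξ p = H) (p : M) :
    LinearMap.trace ℝ (Coord m) (coordShapeOperator g x ξ p * coordShapeOperator g x ξ p) =
      ε * lam := by
  have hlap := laplacian_meanCurvatureVector hlam p
  simp only [hconst] at hlap
  exact (isLocalHypersurface_inChart hmn hx hξ p).trace_sq_shapeOp
    (extChartAt_self_mem_mapChartDomain p) hH hlap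

end ProperMeanCurvature

section FourDimensional

variable {N : Type*} [TopologicalSpace N] [ChartedSpace (EuclideanSpace ℝ (Fin 5)) N]
  {M : Type*} [TopologicalSpace M] [ChartedSpace (EuclideanSpace ℝ (Fin 4)) M]
  {g : PseudoRiemannianMetric 5 N} {x : M → N} {ξ : ∀ p : M, TangentSpace (𝓡 5) (x p)}
  {ε c lam α β : ℝ}

theorem exists_charpoly_coordShapeOperator_eq {p : M}
    (hcard : (principalCurvatures 4 g x ξ p).ncard = 2)
    (him : ∀ μ ∈ principalCurvatures 4 g x ξ p, μ.im ≠ 0) :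
    ∃ α β : ℝ, 0 < β ∧ (coordShapeOperator (m := 4) g x ξ p).charpoly = conjPoly α β ^ 2 :=
  exists_eq_conjPoly_sq (LinearMap.charpoly_monic _)
    (by rw [LinearMap.charpoly_natDegree, finrank_euclideanSpace_fin]) hcard him

variable [IsManifold (𝓡 5) ∞ N] (hx : IsNondegenerateImmersion 4 g x) (hξ : IsUnitNormal 4 g x ξ ε)

include hξ

theorem meanCurvature_eq_of_charpoly_eq {p : M}
    (hA : (coordShapeOperator (m := 4) g x ξ p).charpoly = conjPoly α β ^ 2) :
    meanCurvature 4 g x ξ p = ε * α := by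
  rw [meanCurvature_eq hξ, trace_of_charpoly_eq_conjPoly_sq hA]
  push_cast
  ring

variable [IsManifold (𝓡 4) ∞ M]

include hx

theorem mul_eq_of_charpoly_eq (hlam : HasProperMeanCurvature 4 g x ξ lam) {H : ℝ} (hH : H ≠ 0)
    (hconst : ∀ p : M, meanCurvature 4 g x ξ p = H) {p : M}
    (hA : (coordShapeOperator (m := 4) g x ξ p).charpoly = conjPoly α β ^ 2) :
    ε * lam = 4 * (α ^ 2 - β ^ 2) := by
  rw [← trace_sq_coordShapeOperator rfl hx hξ hlam hH hconst p,
    trace_sq_of_charpoly_eq_conjPoly_sq finrank_euclideanSpace_fin hA]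

theorem exists_forall_charpoly_coordShapeOperator_eq [Nonempty M]
    (hlam : HasProperMeanCurvature 4 g x ξ lam) {H : ℝ} (hH : H ≠ 0)
    (hconst : ∀ p : M, meanCurvature 4 g x ξ p = H)
    (hcurv : ∀ p : M, (principalCurvatures 4 g x ξ p).ncard = 2 ∧
      ∀ μ ∈ principalCurvatures 4 g x ξ p, μ.im ≠ 0) :
    ∃ α β : ℝ, 0 < β ∧
      ∀ p : M, (coordShapeOperator (m := 4) g x ξ p).charpoly = conjPoly α β ^ 2 := by
  choose α β hβ hA using fun p => exists_charpoly_coordShapeOperator_eq (hcurv p).1 (hcurv p).2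
  have hmean := fun p => meanCurvature_eq_of_charpoly_eq hξ (hA p)
  have hlamε := fun p => mul_eq_of_charpoly_eq hx hξ hlam hH hconst (hA p)
  have p₀ : M := Classical.arbitrary M
  have hε := (isLocalHypersurface_inChart rfl hx hξ p₀).sign_ne_zero
  refine ⟨α p₀, β p₀, hβ p₀, fun p => ?_⟩
  have hα : α p = α p₀ := mul_left_cancel₀ hε (by rw [← hmean, ← hmean, hconst, hconst])
  have hβ_eq : β p = β p₀ := by
    refine (sq_eq_sq₀ (hβ p).le (hβ p₀).le).1 ?_
    have h := (hlamε p).symm.trans (hlamε p₀)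
    rw [hα] at h
    linarith
  rw [hA, hα, hβ_eq]

theorem add_mul_eq_zero_of_charpoly_eq [Nonempty M] (hc : g.HasConstantSectionalCurvature c)
    (hβ : β ≠ 0)
    (hA : ∀ p : M, (coordShapeOperator (m := 4) g x ξ p).charpoly = conjPoly α β ^ 2) :
    c + ε * (α ^ 2 + β ^ 2) = 0 := by
  have p₀ : M := Classical.arbitrary M
  refine (isLocalHypersurface_inChart rfl hx hξ p₀).cartan_identity
    (hc.hasConstantCurvature_inChart (by norm_num) (x p₀))
    ⟨_, extChartAt_self_mem_mapChartDomain p₀⟩ finrank_euclideanSpace_fin hβ fun y hy => ?_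
  obtain ⟨e, he⟩ := exists_conj_shapeOpInChart rfl hx hξ hy
  exact aeval_conjPoly_sq_eq_zero_of_conj e (he ▸ aeval_conjPoly_sq_eq_zero (hA _))

theorem sq_meanCurvature_eq_of_meanCurvature_ne_zero [ConnectedSpace M]
    (hc : g.HasConstantSectionalCurvature c) (hlam : HasProperMeanCurvature 4 g x ξ lam)
    (hcurv : ∀ p : M, (principalCurvatures 4 g x ξ p).ncard = 2 ∧
      ∀ μ ∈ principalCurvatures 4 g x ξ p, μ.im ≠ 0)
    {p₀ : M} (hp₀ : meanCurvature 4 g x ξ p₀ ≠ 0) :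
    c * ε < 0 ∧ |ε * lam| < -4 * c * ε ∧
      ∀ p : M, meanCurvature 4 g x ξ p ^ 2 = (ε * lam - 4 * c * ε) / 8 := by
  have hconst : ∀ p : M, meanCurvature 4 g x ξ p = meanCurvature 4 g x ξ p₀ := fun p =>
    meanCurvature_eq_of_hasProperMeanCurvature (by norm_num) rfl hc hx hξ hlam
      (fun p => (hcurv p).2) p p₀
  obtain ⟨α, β, hβ, hA⟩ :=
    exists_forall_charpoly_coordShapeOperator_eq hx hξ hlam hp₀ hconst hcurv
  have hmean := fun p => meanCurvature_eq_of_charpoly_eq hξ (hA p)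
  have hlamε := mul_eq_of_charpoly_eq hx hξ hlam hp₀ hconst (hA p₀)
  have hcartan := add_mul_eq_zero_of_charpoly_eq hx hξ hc hβ.ne' hA
  have hεε := (isLocalHypersurface_inChart rfl hx hξ p₀).sign_mul_self
  have hcε : c * ε = -(α ^ 2 + β ^ 2) := by
    linear_combination ε * hcartan - (α ^ 2 + β ^ 2) * hεε
  have hα : 0 < α ^ 2 := by
    rw [hmean] at hp₀
    have := right_ne_zero_of_mul hp₀
    positivity
  have hβ2 : 0 < β ^ 2 := by positivity
  refine ⟨by linarith, abs_lt.2 ⟨by linarith, by linarith⟩, fun p => ?_⟩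
  rw [hmean]
  linear_combination α ^ 2 * hεε - (1 / 8) * hlamε + (1 / 2) * hcε

end FourDimensional

end

theorem theorem4p8
    {N : Type*} [TopologicalSpace N] [ChartedSpace (EuclideanSpace ℝ (Fin 5)) N]
    [IsManifold (𝓡 5) ∞ N]
    {M : Type*} [TopologicalSpace M] [ChartedSpace (EuclideanSpace ℝ (Fin 4)) M]
    [IsManifold (𝓡 4) ∞ M] [ConnectedSpace M]
    (g : PseudoRiemannianMetric 5 N) (c : ℝ) (hc : g.HasConstantSectionalCurvature c)
    (x : M → N) (hx : IsNondegenerateImmersion 4 g x)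
    (ξ : ∀ p : M, TangentSpace (𝓡 5) (x p)) (ε : ℝ) (hξ : IsUnitNormal 4 g x ξ ε)
    (lam : ℝ) (hlam : HasProperMeanCurvature 4 g x ξ lam)
    (hcurv : ∀ p : M, (principalCurvatures 4 g x ξ p).ncard = 2 ∧
      ∀ μ ∈ principalCurvatures 4 g x ξ p, μ.im ≠ 0) :
    (0 ≤ c * ε → ∀ p : M, meanCurvature 4 g x ξ p = 0) ∧
    (c * ε < 0 → -4 * c * ε ≤ |ε * lam| → ∀ p : M, meanCurvature 4 g x ξ p = 0) ∧
    (c * ε < 0 → |ε * lam| < -4 * c * ε →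
      (∀ p : M, meanCurvature 4 g x ξ p = 0) ∨
        ∀ p : M, meanCurvature 4 g x ξ p ^ 2 = (ε * lam - 4 * c * ε) / 8) := by
  by_cases hzero : ∀ p : M, meanCurvature 4 g x ξ p = 0
  · exact ⟨fun _ => hzero, fun _ _ => hzero, fun _ _ => Or.inl hzero⟩
  obtain ⟨p₀, hp₀⟩ := not_forall.1 hzero
  obtain ⟨hcε, hbound, hsq⟩ := sq_meanCurvature_eq_of_meanCurvature_ne_zero hx hξ hc hlam hcurv hp₀
  exact ⟨fun h => absurd hcε h.not_gt, fun _ h => absurd hbound h.not_gt, fun _ _ => Or.inr hsq⟩
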